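/- **Theorem (Transport duality).** Let $\Omega$ be either a compact convex subset of $\mathbb R^d$ with non-empty interior, or the flat torus $\mathbb T^d=\mathbb R^d/\mathbb Z^d$ (functions on the torus are identified with their $\mathbb Z^d$-periodic lifts to $\mathbb R^d$, and $\int_\Omega$ is then the integral over the unit cube). Let $\mathcal P(\Omega)$ be the set of probability densities $p\in C^\infty(\Omega)$, $p\ge 0$, $\int_\Omega p\,dx=1$, and let $\mathcal F\colon\mathcal P(\Omega)\to\mathbb R$ be a functional and $q\in\mathcal P(\Omega)$ a reference density. *Transport coordinates.* A transport coordinate is a smooth function $\Phi$ with positive definite Hessian whose gradient $\nabla\Phi$ maps $\Omega$ bijectively onto $\Omega$; for the torus, $\Phi$ is a smooth function on $\mathbb R^d$ such that $\Phi-\tfrac12\|\cdot\|^2$ is periodic, and $\nabla\Phi$ is a bijection of $\mathbb R^d$. The density $p=\nabla\Phi_\#q$ is given by $p(\nabla\Phi(x))\det\nabla^2\Phi(x)=q(x)$. Put $\Phi_q(x)=\tfrac12\|x\|^2$, so that $\nabla\Phi_q=\mathrm{id}$. Let $K$ be a set of transport coordinates which is invariant under adding constants (for example, all of them), and set $$\tilde{\mathcal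 F}(\Phi)=\mathcal F(\nabla\Phi_\#q),\qquad \Phi\in K .$$ Assume that $\tilde{\mathcal F}$ is a convex functional on $K$ (in particular, that $K$ is convex). *First variations.* For a functional $G$ on a set $\mathcal D$ of functions and $f\in\mathcal D$, a function $g$ is called an $L^2$ first variation of $G$ at $f$, $g=\frac{\delta}{\delta f}G(f)$, if $\frac{d}{dt}G(c_t)\big|_{t=0^+}=\int_\Omega g\,\partial_tc_t|_{t=0^+}\,dx$ for every curve $(c_t)_{0\le t\le1}$ in $\mathcal D$ with $c_0=f$ which is smooth in $(t,x)$. This is applied to $\mathcal F$ on $\mathcal P(\Omega)$, to $\tilde{\mathcal F}$ on $K$, and to the conjugate $$\tilde{\mathcal F}^*(\Phi^*)=\sup_{\Phi\in K}\ \int_\Omega\Phi\,\Phi^*\,dx-\tilde{\mathcal F}(\Phi)$$ on the set $\mathcal M=\{\Phi^*\in C^\infty(\Omega)\colon\int_\Omega\Phi^*dx=0\}$, on which the pairing with $\Phi$ modulo constants is well defined. The first variations of $\mathcal F$ and $\tilde{\mathcal F}$ are taken in $C^\infty(\Omega)$. Those of $\tilde{\mathcal F}^*$ are smooth functions $\Psi$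 which, in the torus case, are such that $\Psi-\tfrac12\|\cdot\|^2$ is periodic. If $\tilde{\mathcal F}$ has a first variation $\Phi^*\in C^\infty(\Omega)$ at some $\Phi\in K$, then $\Phi^*\in\mathcal M$ and $\tilde{\mathcal F}^*$ is finite on $\mathcal M$. Moreover, the following hold whenever the first variations that occur in them exist. (i) For $\Phi\in K$, $$\nabla_x\frac{\delta}{\delta\Phi^*(x)}\tilde{\mathcal F}^*\Big(\frac{\delta}{\delta\Phi}\tilde{\mathcal F}(\Phi)\Big)=\nabla_x\Phi(x),\qquad x\in\Omega .$$ (ii) Let $\Phi_q\in K$, and let $p\in\mathcal P(\Omega)$ with $p=(\nabla\Phi_p)_\#q$, $\Phi_p\in K$. Then $$\mathrm D_{\mathrm T,\mathcal F}(p\|q)=\mathrm D_{\tilde{\mathcal F}}(\Phi_p\|\Phi_q),$$ where $$\mathrm D_{\mathrm T,\mathcal F}(p\|q)=\mathcal F(p)-\mathcal F(q)-\int_\Omega\Big(\nabla_x\frac{\delta}{\delta q(x)}\mathcal F(q),\nabla\Phi_p(x)-\nabla\Phi_q(x)\Big)q(x)\,dx,$$ $$\mathrm D_{\tilde{\mathcal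 F}}(\Phi_p\|\Phi_q)=\tilde{\mathcal F}(\Phi_p)-\tilde{\mathcal F}(\Phi_q)-\int_\Omega(\Phi_p-\Phi_q)\,\frac{\delta}{\delta\Phi_q}\tilde{\mathcal F}(\Phi_q)\,dx .$$ (iii) In the situation of (ii), with $\Phi_p^*=\frac{\delta}{\delta\Phi_p}\tilde{\mathcal F}(\Phi_p)$ and $\Phi_q^*=\frac{\delta}{\delta\Phi_q}\tilde{\mathcal F}(\Phi_q)$, $$\mathrm D_{\tilde{\mathcal F}}(\Phi_p\|\Phi_q)=\mathrm D_{\tilde{\mathcal F}^*}(\Phi_q^*\|\Phi_p^*)=\mathrm D_{\mathrm T,\mathcal F}(p\|q),$$ where $$\mathrm D_{\tilde{\mathcal F}^*}(\Phi_q^*\|\Phi_p^*)=\tilde{\mathcal F}^*(\Phi_q^*)-\tilde{\mathcal F}^*(\Phi_p^*)-\int_\Omega(\Phi_q^*-\Phi_p^*)\,\frac{\delta}{\delta\Phi_p^*}\tilde{\mathcal F}^*(\Phi_p^*)\,dx .$$ -/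

import Mathlib

open Set MeasureTheory
open scoped ContDiff

noncomputable section

/-- The ambient Euclidean space `ℝ^d`. -/
abbrev E (d : ℕ) : Type := EuclideanSpace ℝ (Fin d)

/-- The sample spaces: a `d`-dimensional compact convex set in `ℝ^d`, or the flat torus
`𝕋^d = ℝ^d / ℤ^d`. Objects on the torus are described by their lifts to `ℝ^d`. -/
inductive SampleSpace (d : ℕ) : Type
  | body (Ω : Set (E d)) (isCompact : IsCompact Ω) (convex : Convex ℝ Ω)
      (nonempty_interior : (interior Ω).Nonempty) : SampleSpace d
  | torus : SampleSpace d

namespace SampleSpace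

variable {d : ℕ}

/-- The set on which (lifted) functions live: `Ω` itself, or all of `ℝ^d` for the torus. -/
def carrier : SampleSpace d → Set (E d)
  | body Ω _ _ _ => Ω
  | torus => univ

/-- The set over which one integrates: `Ω` itself, or the unit cube for the torus. -/
def cell : SampleSpace d → Set (E d)
  | body Ω _ _ _ => Ω
  | torus => {x | ∀ i, x i ∈ Ico (0 : ℝ) 1}

/-- The group of periods: trivial for a convex set, `ℤ^d` for the torus. -/
def periods : SampleSpace d → Set (E d)
  | body _ _ _ _ => {0}
  | torus => {v | ∀ i, ∃ n : ℤ, v i = n}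

/-- `C^∞(Ω)`: functions smooth up to the boundary on a convex set; periodic smooth functions for
the torus. -/
def smooth (S : SampleSpace d) : Set (E d → ℝ) :=
  {f | ContDiffOn ℝ ∞ f S.carrier ∧ ∀ v ∈ S.periods, ∀ x, f (x + v) = f x}

/-- `∫_Ω f(x) dx`. -/
def integral (S : SampleSpace d) (f : E d → ℝ) : ℝ := ∫ x in S.cell, f x

/-- `∇f` on `Ω` (one-sided at boundary points of a convex set). -/
def grad (S : SampleSpace d) (f : E d → ℝ) (x : E d) : E d := gradientWithin f S.carrier x

/-- The Hessian `∇²f(x)`, i.e. the Jacobian operator of `∇f`. -/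
def hess (S : SampleSpace d) (f : E d → ℝ) (x : E d) : E d →L[ℝ] E d :=
  fderivWithin ℝ (S.grad f) S.carrier x

/-- `𝒫(Ω)`: smooth probability densities (extended by `0` outside a convex set, so that a density
on `Ω` is represented by exactly one function). -/
def densities (S : SampleSpace d) : Set (E d → ℝ) :=
  {p | p ∈ S.smooth ∧ (∀ x, 0 ≤ p x) ∧ (∀ x, x ∉ S.carrier → p x = 0) ∧ S.integral p = 1}

/-- `Φ_q(x) = ‖x‖² / 2`, the transport coordinate of the reference density. -/
def quad (x : E d) : ℝ := ‖x‖ ^ 2 / 2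

/-- The smooth potentials. On a convex set these are all smooth functions; on the torus these are
the smooth functions `Φ` on `ℝ^d` such that `Φ - ‖·‖²/2` is periodic, which says that the map `∇Φ`
is the identity plus a periodic gradient field and so descends to the torus. -/
def potentials (S : SampleSpace d) : Set (E d → ℝ) :=
  match S with
  | body Ω _ _ _ => {Φ | ContDiffOn ℝ ∞ Φ Ω}
  | torus => {Φ | (fun x => Φ x - quad x) ∈ (torus : SampleSpace d).smooth}

/-- The transport coordinates: smooth strictly convex potentials (with positive definite Hessian)
whose gradient map is a diffeomorphism of `Ω` onto itself. -/
def coords (S : SampleSpace d) : Set (E d → ℝ) :=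
  {Φ | Φ ∈ S.potentials ∧
    (∀ x ∈ S.carrier, ∀ v : E d, v ≠ 0 → 0 < inner ℝ (S.hess Φ x v) v) ∧
    BijOn (S.grad Φ) S.carrier S.carrier}

/-- `p = (∇Φ)_# q` for densities: `p(∇Φ(x)) det(∇²Φ(x)) = q(x)`. -/
def IsPush (S : SampleSpace d) (Φ q p : E d → ℝ) : Prop :=
  ∀ x ∈ S.carrier, p (S.grad Φ x) * (S.hess Φ x).det = q x

open Classical in
/-- The density `(∇Φ)_# q`, i.e. `y ↦ q(x) / det(∇²Φ(x))` with `x = (∇Φ)⁻¹(y)`. -/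
def push (S : SampleSpace d) (Φ q : E d → ℝ) (y : E d) : ℝ :=
  if y ∈ S.carrier then
    q (Function.invFunOn (S.grad Φ) S.carrier y) /
      (S.hess Φ (Function.invFunOn (S.grad Φ) S.carrier y)).det
  else 0

/-- `push` is the pushforward density. -/
theorem isPush_push (S : SampleSpace d) {Φ : E d → ℝ} (hΦ : Φ ∈ S.coords) (q : E d → ℝ) :
    S.IsPush Φ q (S.push Φ q) := by
  obtain ⟨-, hpos, hbij⟩ := hΦ
  intro x hx
  have hdet : (S.hess Φ x).det ≠ 0 := by
    intro h0
    have : LinearMap.det ((S.hess Φ x) : E d →ₗ[ℝ] E d) = 0 := h0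
    obtain ⟨v, hv, hv0⟩ := (Submodule.ne_bot_iff _).1 (LinearMap.bot_lt_ker_of_det_eq_zero this).ne'
    have h1 := hpos x hx v hv0
    have h2 : S.hess Φ x v = 0 := by simpa using hv
    rw [h2] at h1
    simp at h1
  have hinv : Function.invFunOn (S.grad Φ) S.carrier (S.grad Φ x) = x :=
    hbij.injOn.leftInvOn_invFunOn hx
  rw [push, if_pos (hbij.mapsTo hx), hinv, div_mul_cancel₀ _ hdet]

/-- `F̃(Φ) = F((∇Φ)_# q)`. -/
def lift (S : SampleSpace d) (F : (E d → ℝ) → ℝ) (q : E d → ℝ) (Φ : E d → ℝ) : ℝ :=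
  F (S.push Φ q)

/-- The `L²` first variation of a functional `G`, defined on the set `dom` of functions: `g` is the
first variation of `G` at `f` if, for every smooth curve `c_t`, `0 ≤ t ≤ 1`, in `dom` that starts
at `f`, one has `d/dt G(c_t) = ∫_Ω g(x) ∂_t c_t(x) dx` at `t = 0`. -/
def IsFirstVariation (S : SampleSpace d) (dom : Set (E d → ℝ)) (G : (E d → ℝ) → ℝ)
    (f g : E d → ℝ) : Prop :=
  f ∈ dom ∧ ∀ c : ℝ → E d → ℝ,
    ContDiffOn ℝ ∞ (fun z : ℝ × E d => c z.1 z.2) (Icc (0 : ℝ) 1 ×ˢ S.carrier) →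
    (∀ t ∈ Icc (0 : ℝ) 1, c t ∈ dom) → c 0 = f →
    HasDerivWithinAt (fun t => G (c t))
      (S.integral fun x => g x * derivWithin (fun t => c t x) (Icc (0 : ℝ) 1) 0)
      (Icc (0 : ℝ) 1) 0

/-- The dual variables: smooth functions with zero mean. These are exactly the `Φ*` for which
`∫_Ω Φ Φ* dx` is well defined for `Φ` modulo constants. -/
def duals (S : SampleSpace d) : Set (E d → ℝ) :=
  {f | f ∈ S.smooth ∧ S.integral f = 0}

/-- The values `∫_Ω Φ Φ* dx - G(Φ)`, for `Φ` in the domain `K` of `G`. -/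
def conjValues (S : SampleSpace d) (K : Set (E d → ℝ)) (G : (E d → ℝ) → ℝ) (Φs : E d → ℝ) :
    Set ℝ :=
  {r | ∃ Φ ∈ K, r = S.integral (fun x => Φ x * Φs x) - G Φ}

/-- The `L²` Legendre conjugate `G*(Φ*) = sup_{Φ ∈ K} ∫_Ω Φ Φ* dx - G(Φ)`. -/
def conj (S : SampleSpace d) (K : Set (E d → ℝ)) (G : (E d → ℝ) → ℝ) (Φs : E d → ℝ) : ℝ :=
  sSup (S.conjValues K G Φs)

/-- The `L²` Bregman divergence
`D_G(f₁‖f₂) = G(f₁) - G(f₂) - ∫_Ω (f₁ - f₂) g₂ dx`, with `g₂` the first variation of `G` at `f₂`. -/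
def bregman (S : SampleSpace d) (G : (E d → ℝ) → ℝ) (f₁ f₂ g₂ : E d → ℝ) : ℝ :=
  G f₁ - G f₂ - S.integral fun x => (f₁ x - f₂ x) * g₂ x

/-- The transport Bregman divergence
`D_{T,F}(p‖q) = F(p) - F(q) - ∫_Ω (∇ξ, ∇Φ_p - ∇Φ_q) q dx`, with `ξ` the first variation of `F`
at `q` and `Φ_p` the transport coordinate of `p`. -/
def transportBregman (S : SampleSpace d) (F : (E d → ℝ) → ℝ) (p q Φp ξ : E d → ℝ) : ℝ :=
  F p - F q - S.integral fun x => inner ℝ (S.grad ξ x) (S.grad Φp x - S.grad quad x) * q x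

end SampleSpace

end

/-! Along the straight line of transport coordinates from `quad` to `Φ_p`, the densities
`(∇Φ_t)_# q` form a smooth curve in `𝒫(Ω)`. The change of variables
`∫ ξ (∇Φ_t)_# q dx = ∫ (ξ ∘ ∇Φ_t) q dx` identifies its velocity, and comparing the first variations
of `F` and `F̃` along the two curves turns one divergence into the other.

A first variation of a convex functional is a subgradient, hence a case of equality in Fenchel's
inequality. The conjugate is finite because transport coordinates have uniformly bounded
oscillation, up to `quad` on the torus. A first variation of the conjugate pairs with
mean-zero functions as `Φ` does, so it equals `Φ` up to a constant. -/

open Filter Topology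
open scoped Pointwise

section Calculus

theorem contDiffOn_of_rightInverse {𝕜 X Y : Type*} [NontriviallyNormedField 𝕜]
    [NormedAddCommGroup X] [NormedSpace 𝕜 X] [CompleteSpace X] [NormedAddCommGroup Y]
    [NormedSpace 𝕜 Y] {n : ℕ∞} {s : Set X} {t : Set Y} {f : X → Y} {g : Y → X}
    (hs : UniqueDiffOn 𝕜 s) (ht : UniqueDiffOn 𝕜 t) (hf : ContDiffOn 𝕜 n f s) (hgs : MapsTo g t s)
    (hfg : RightInvOn g f t) (hg : ContinuousOn g t)
    (hinv : ∀ x ∈ s, (fderivWithin 𝕜 f s x).IsInvertible) : ContDiffOn 𝕜 n g t := by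
  have hderiv (hdiff : DifferentiableOn 𝕜 f s) :
      ∀ y ∈ t, HasFDerivWithinAt g (fderivWithin 𝕜 f s (g y)).inverse t y := by
    intro y hy
    obtain ⟨e, he⟩ := hinv (g y) (hgs hy)
    have hfy : HasFDerivWithinAt f (e : X →L[𝕜] Y) s (g y) :=
      he ▸ (hdiff (g y) (hgs hy)).hasFDerivWithinAt
    rw [← he, ContinuousLinearMap.inverse_equiv]
    exact hfy.of_local_left_inverse ((hg y hy).tendsto_nhdsWithin hgs) hy
      (eventually_mem_nhdsWithin.mono hfg)
  have hsucc (k : ℕ) (ih : ContDiffOn 𝕜 k f s → ContDiffOn 𝕜 k g t)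
      (hf : ContDiffOn 𝕜 (k + 1 : ℕ) f s) : ContDiffOn 𝕜 (k + 1 : ℕ) g t := by
    rw [Nat.cast_add_one] at hf ⊢
    rw [contDiffOn_succ_iff_hasFDerivWithinAt_of_uniqueDiffOn ht]
    refine ⟨by simp, _, fun y hy => ?_, hderiv (hf.differentiableOn (by simp))⟩
    have hinverse : ContDiffAt 𝕜 k ContinuousLinearMap.inverse (fderivWithin 𝕜 f s (g y)) := by
      obtain ⟨e, he⟩ := hinv (g y) (hgs hy)
      exact he ▸ contDiffAt_map_inverse e
    exact hinverse.comp_contDiffWithinAt y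
      ((hf.fderivWithin hs le_rfl).comp (ih hf.of_succ) hgs y hy)
  have hnat (k : ℕ) : ContDiffOn 𝕜 k f s → ContDiffOn 𝕜 k g t := by
    induction k with
    | zero => exact fun _ => contDiffOn_zero.2 hg
    | succ k ih => exact hsucc k ih
  induction n using ENat.recTopCoe with
  | top => exact contDiffOn_infty.2 fun k => hnat k (contDiffOn_infty.1 hf k)
  | coe k => exact hnat k hf

section Parametric

variable {𝕜 P X Y : Type*} [NontriviallyNormedField 𝕜] [NormedAddCommGroup P] [NormedSpace 𝕜 P]
  [NormedAddCommGroup X] [NormedSpace 𝕜 X] [NormedAddCommGroup Y] [NormedSpace 𝕜 Y]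
  {I : Set P} {s : Set X} {t : Set Y} {f : P → X → Y} {g : P → Y → X}

theorem continuousOn_of_parametric_rightInverse {m : ℝ} (hm : 0 < m)
    (hf : ContinuousOn (fun z : P × X => f z.1 z.2) (I ×ˢ s))
    (hgs : ∀ p ∈ I, MapsTo (g p) t s) (hfg : ∀ p ∈ I, RightInvOn (g p) (f p) t)
    (hexp : ∀ p ∈ I, ∀ x ∈ s, ∀ y ∈ s, m * ‖x - y‖ ≤ ‖f p x - f p y‖) :
    ContinuousOn (fun z : P × Y => g z.1 z.2) (I ×ˢ t) := by
  rintro ⟨p₀, y₀⟩ ⟨hp₀, hy₀⟩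
  have hx₀ := hgs p₀ hp₀ hy₀
  have hcont : ContinuousWithinAt (fun z : P × Y => m⁻¹ * ‖z.2 - f z.1 (g p₀ y₀)‖) (I ×ˢ t)
      (p₀, y₀) := by
    have := (hf (p₀, g p₀ y₀) ⟨hp₀, hx₀⟩).comp (s := I ×ˢ t) (x := (p₀, y₀))
      (f := fun z : P × Y => (z.1, g p₀ y₀)) (by fun_prop) fun z hz => ⟨hz.1, hx₀⟩
    exact continuousWithinAt_const.mul (continuousWithinAt_snd.sub this).norm
  have hlim : Tendsto (fun z : P × Y => m⁻¹ * ‖z.2 - f z.1 (g p₀ y₀)‖) (𝓝[I ×ˢ t] (p₀, y₀))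
      (𝓝 0) := by
    simpa [ContinuousWithinAt, hfg p₀ hp₀ hy₀] using hcont
  refine tendsto_iff_norm_sub_tendsto_zero.2
    (squeeze_zero' (.of_forall fun _ => norm_nonneg _) ?_ hlim)
  filter_upwards [self_mem_nhdsWithin] with z hz
  rw [le_inv_mul_iff₀ hm]
  simpa only [hfg z.1 hz.1 hz.2] using hexp z.1 hz.1 _ (hgs z.1 hz.1 hz.2) _ hx₀

theorem differentiableOn_slice_left {x : X} (hx : x ∈ s)
    (hf : DifferentiableOn 𝕜 (fun z : P × X => f z.1 z.2) (I ×ˢ s)) :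
    DifferentiableOn 𝕜 (fun p => f p x) I :=
  hf.comp (f := fun p => (p, x)) (by fun_prop) fun _ hp => ⟨hp, hx⟩

theorem contDiffOn_fderivWithin_slice {m n : WithTop ℕ∞} (hmn : m + 1 ≤ n)
    (hs : UniqueDiffOn 𝕜 s) (hf : ContDiffOn 𝕜 n (fun z : P × X => f z.1 z.2) (I ×ˢ s)) :
    ContDiffOn 𝕜 m (fun z : P × X => fderivWithin 𝕜 (f z.1) s z.2) (I ×ˢ s) := fun z hz =>
  ContDiffWithinAt.fderivWithin (f := fun z : P × X => f z.1) (g := Prod.snd)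
    ((hf z hz).comp (z, z.2) (f := fun w : (P × X) × X => (w.1.1, w.2)) (by fun_prop)
      fun _ hw => ⟨hw.1.1, hw.2⟩)
    contDiffWithinAt_snd hs hmn hz fun _ hw => hw.2

theorem isInvertible_fderivWithin_prodMk_fst (hI : UniqueDiffOn 𝕜 I) (hs : UniqueDiffOn 𝕜 s)
    {p : P} {x : X} (hp : p ∈ I) (hx : x ∈ s)
    (hf : DifferentiableWithinAt 𝕜 (fun z : P × X => f z.1 z.2) (I ×ˢ s) (p, x))
    (hinv : (fderivWithin 𝕜 (f p) s x).IsInvertible) :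
    (fderivWithin 𝕜 (fun z : P × X => (z.1, f z.1 z.2)) (I ×ˢ s) (p, x)).IsInvertible := by
  set D := fderivWithin 𝕜 (fun z : P × X => f z.1 z.2) (I ×ˢ s) (p, x)
  have hD : HasFDerivWithinAt (fun z : P × X => f z.1 z.2) D (I ×ˢ s) (p, x) :=
    hf.hasFDerivWithinAt
  have hslice : fderivWithin 𝕜 (f p) s x = D.comp (.inr 𝕜 P X) :=
    (hD.comp x (hasFDerivAt_prodMk_right p x).hasFDerivWithinAt
      fun _ hy => ⟨hp, hy⟩).fderivWithin (hs x hx)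
  obtain ⟨e, he⟩ := hslice ▸ hinv
  rw [(hasFDerivWithinAt_fst.prodMk hD).fderivWithin (hI.prod hs _ ⟨hp, hx⟩)]
  refine ⟨(ContinuousLinearEquiv.refl 𝕜 P).skewProd e (D.comp (.inl 𝕜 P X)), ?_⟩
  have hev (v : X) : e v = D (0, v) := congr($he v)
  ext v <;> simp [hev, Prod.mk_zero_zero]

theorem contDiffOn_of_parametric_rightInverse [CompleteSpace P] [CompleteSpace X] {n : ℕ∞}
    (hn : n ≠ 0) {m : ℝ} (hm : 0 < m) (hI : UniqueDiffOn 𝕜 I) (hs : UniqueDiffOn 𝕜 s)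
    (ht : UniqueDiffOn 𝕜 t) (hf : ContDiffOn 𝕜 n (fun z : P × X => f z.1 z.2) (I ×ˢ s))
    (hgs : ∀ p ∈ I, MapsTo (g p) t s) (hfg : ∀ p ∈ I, RightInvOn (g p) (f p) t)
    (hexp : ∀ p ∈ I, ∀ x ∈ s, ∀ y ∈ s, m * ‖x - y‖ ≤ ‖f p x - f p y‖)
    (hinv : ∀ p ∈ I, ∀ x ∈ s, (fderivWithin 𝕜 (f p) s x).IsInvertible) :
    ContDiffOn 𝕜 n (fun z : P × Y => g z.1 z.2) (I ×ˢ t) := by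
  have hgraph : ContDiffOn 𝕜 n (fun z : P × Y => (z.1, g z.1 z.2)) (I ×ˢ t) :=
    contDiffOn_of_rightInverse (f := fun z : P × X => (z.1, f z.1 z.2)) (hI.prod hs)
      (hI.prod ht) (contDiffOn_fst.prodMk hf) (fun z hz => ⟨hz.1, hgs z.1 hz.1 hz.2⟩)
      (fun z hz => Prod.ext rfl (hfg z.1 hz.1 hz.2))
      (continuousOn_fst.prodMk
        (continuousOn_of_parametric_rightInverse hm hf.continuousOn hgs hfg hexp))
      fun z hz => isInvertible_fderivWithin_prodMk_fst hI hs hz.1 hz.2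
        (hf.differentiableOn (by exact_mod_cast hn) z hz) (hinv z.1 hz.1 z.2 hz.2)
  exact contDiff_snd.comp_contDiffOn hgraph

end Parametric

theorem contDiff_continuousLinearMap_det {𝕜 V : Type*} [NontriviallyNormedField 𝕜]
    [CompleteSpace 𝕜] [NormedAddCommGroup V] [NormedSpace 𝕜 V] [FiniteDimensional 𝕜 V]
    {n : WithTop ℕ∞} : ContDiff 𝕜 n (fun A : V →L[𝕜] V => A.det) := by
  let b := Module.finBasis 𝕜 V
  have hentry (i j) : ContDiff 𝕜 n (fun A : V →L[𝕜] V => b.coord i (A (b j))) :=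
    ((b.coord i).toContinuousLinearMap.comp
      (ContinuousLinearMap.apply 𝕜 V (b j))).contDiff
  have hdet (A : V →L[𝕜] V) : A.det = (Matrix.of fun i j => b.coord i (A (b j))).det := by
    rw [ContinuousLinearMap.det, ← LinearMap.det_toMatrix b]
    congr 1
    ext i j
    simp [LinearMap.toMatrix_apply]
  simp only [hdet, Matrix.det_apply, Matrix.of_apply]
  exact ContDiff.sum fun σ _ => (contDiff_prod fun i _ => hentry _ _).const_smul _

theorem hasDerivWithinAt_const_add_smul {𝕜 F : Type*} [NontriviallyNormedField 𝕜]
    [NormedAddCommGroup F] [NormedSpace 𝕜 F] (a b : F) (s : Set 𝕜) (t : 𝕜) :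
    HasDerivWithinAt (fun t => a + t • b) b s t := by
  simpa only [one_smul, id_eq] using ((hasDerivWithinAt_id t s).smul_const b).const_add a

theorem le_of_hasDerivWithinAt_of_le {f g : ℝ → ℝ} {f' g' a b : ℝ} (hab : a < b)
    (hf : HasDerivWithinAt f f' (Icc a b) a) (hg : HasDerivWithinAt g g' (Icc a b) a)
    (heq : f a = g a) (hle : ∀ t ∈ Icc a b, f t ≤ g t) : f' ≤ g' := by
  rw [hasDerivWithinAt_iff_tendsto_slope, Icc_sdiff_left] at hf hg
  have : (𝓝[Ioc a b] a).NeBot := left_nhdsWithin_Ioc_neBot hab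
  refine le_of_tendsto_of_tendsto hf hg ?_
  filter_upwards [self_mem_nhdsWithin] with t ht
  rw [slope_def_field, slope_def_field, heq]
  exact div_le_div_of_nonneg_right (sub_le_sub_right (hle t (Ioc_subset_Icc_self ht)) _)
    (sub_nonneg.2 ht.1.le)

theorem hasDerivWithinAt_integral_of_dominated {α G : Type*} [MeasurableSpace α] {μ : Measure α}
    [NormedAddCommGroup G] [NormedSpace ℝ G] {I : Set ℝ} (hI : Convex ℝ I) {t₀ : ℝ} (ht₀ : t₀ ∈ I)
    {h h' : ℝ → α → G} {bound : α → ℝ} (hint : ∀ t ∈ I, Integrable (h t) μ)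
    (hbound : Integrable bound μ) (hle : ∀ᵐ x ∂μ, ∀ t ∈ I, ‖h' t x‖ ≤ bound x)
    (hderiv : ∀ᵐ x ∂μ, ∀ t ∈ I, HasDerivWithinAt (fun t => h t x) (h' t x) I t) :
    HasDerivWithinAt (fun t => ∫ x, h t x ∂μ) (∫ x, h' t₀ x ∂μ) I t₀ := by
  rw [hasDerivWithinAt_iff_tendsto_slope]
  have hslope : Tendsto (fun t => ∫ x, slope (fun t => h t x) t₀ t ∂μ) (𝓝[I \ {t₀}] t₀)
      (𝓝 (∫ x, h' t₀ x ∂μ)) := by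
    refine tendsto_integral_filter_of_dominated_convergence bound ?_ ?_ hbound ?_
    · filter_upwards [self_mem_nhdsWithin] with t ht
      simp only [slope_def_module]
      exact ((hint t ht.1).sub (hint t₀ ht₀)).aestronglyMeasurable.const_smul _
    · filter_upwards [self_mem_nhdsWithin] with t ht
      filter_upwards [hle, hderiv] with x hle hderiv
      have hlip := hI.norm_image_sub_le_of_norm_hasDerivWithin_le hderiv hle ht₀ ht.1
      rw [slope_def_module, norm_smul, norm_inv,
        inv_mul_le_iff₀ (norm_pos_iff.2 (sub_ne_zero.2 ht.2)), mul_comm]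
      exact hlip
    · filter_upwards [hderiv] with x hderiv
      exact hasDerivWithinAt_iff_tendsto_slope.1 (hderiv t₀ ht₀)
  refine hslope.congr' ?_
  filter_upwards [self_mem_nhdsWithin] with t ht
  simp only [slope_def_module]
  rw [integral_smul, integral_sub (hint t ht.1) (hint t₀ ht₀)]

theorem hasDerivWithinAt_setIntegral_of_contDiffOn {X G : Type*} [NormedAddCommGroup X]
    [NormedSpace ℝ X] [MeasurableSpace X] [BorelSpace X] {μ : Measure X}
    [IsFiniteMeasureOnCompacts μ] [NormedAddCommGroup G] [NormedSpace ℝ G] {s A : Set X}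
    (hs : UniqueDiffOn ℝ s) (hA : MeasurableSet A) (hAc : IsCompact (closure A))
    (hAs : closure A ⊆ s) {a b t₀ : ℝ} (hab : a < b) (ht₀ : t₀ ∈ Icc a b) {h : ℝ → X → G}
    (hh : ContDiffOn ℝ 1 (fun z : ℝ × X => h z.1 z.2) (Icc a b ×ˢ s)) :
    HasDerivWithinAt (fun t => ∫ x in A, h t x ∂μ)
      (∫ x in A, derivWithin (fun t => h t x) (Icc a b) t₀ ∂μ) (Icc a b) t₀ := by
  have hI : UniqueDiffOn ℝ (Icc a b) := uniqueDiffOn_Icc hab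
  let D := fderivWithin ℝ (fun z : ℝ × X => h z.1 z.2) (Icc a b ×ˢ s)
  have hslice : ∀ x ∈ s, ∀ t ∈ Icc a b,
      HasDerivWithinAt (fun t => h t x) (D (t, x) (1, 0)) (Icc a b) t := by
    intro x hx t ht
    have hline : HasDerivWithinAt (fun t : ℝ => (t, x)) (1, 0) (Icc a b) t :=
      (hasDerivWithinAt_id t _).prodMk (hasDerivWithinAt_const t _ x)
    exact (hh.differentiableOn one_ne_zero (t, x) ⟨ht, hx⟩).hasFDerivWithinAt.comp_hasDerivWithinAt
      t hline fun r hr => mk_mem_prod hr hx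
  have hcont : ContinuousOn (fun z => derivWithin (fun t => h t z.2) (Icc a b) z.1)
      (Icc a b ×ˢ s) :=
    ((hh.continuousOn_fderivWithin (hI.prod hs) le_rfl).clm_apply continuousOn_const).congr
      fun z hz => (hslice z.2 hz.2 z.1 hz.1).derivWithin (hI z.1 hz.1)
  obtain ⟨M, hM⟩ := (isCompact_Icc.prod hAc).exists_bound_of_continuousOn
    (hcont.mono (prod_mono_right hAs))
  have hae {p : X → Prop} (hp : ∀ x ∈ closure A, p x) : ∀ᵐ x ∂μ.restrict A, p x :=
    (ae_restrict_mem hA).mono fun x hx => hp x (subset_closure hx)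
  refine hasDerivWithinAt_integral_of_dominated (convex_Icc a b) ht₀ (bound := fun _ => M)
    (h' := fun t x => derivWithin (fun t => h t x) (Icc a b) t) (fun t ht => ?_) ?_
    (hae fun x hx t ht => hM (t, x) ⟨ht, hx⟩)
    (hae fun x hx t ht => (hslice x (hAs hx) t ht).differentiableWithinAt.hasDerivWithinAt)
  · have : ContinuousOn (h t) (closure A) := hh.continuousOn.comp (f := fun x => (t, x))
      (by fun_prop) fun x hx => ⟨ht, hAs hx⟩
    exact (this.integrableOn_compact hAc).mono_set subset_closure
  · exact integrableOn_const ((measure_mono subset_closure).trans_lt hAc.measure_lt_top).ne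

end Calculus

section InnerProductSpace

variable {V : Type*} [NormedAddCommGroup V] [InnerProductSpace ℝ V]

theorem le_inner_sub_of_hasFDerivWithinAt {s : Set V} (hs : Convex ℝ s) {T : V → V}
    {T' : V → V →L[ℝ] V} {m : ℝ} (hT : ∀ x ∈ s, HasFDerivWithinAt T (T' x) s x)
    (hm : ∀ x ∈ s, ∀ v, m * ‖v‖ ^ 2 ≤ inner ℝ (T' x v) v) {x y : V} (hx : x ∈ s) (hy : y ∈ s) :
    m * ‖y - x‖ ^ 2 ≤ inner ℝ (T y - T x) (y - x) := by
  have hderiv : ∀ z ∈ s, HasFDerivWithinAt (fun z => inner ℝ (y - x) (T z))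
      ((innerSL ℝ (y - x)).comp (T' z)) s z := fun z hz =>
    (innerSL ℝ (y - x)).hasFDerivAt.comp_hasFDerivWithinAt z (hT z hz)
  obtain ⟨z, hz, hmvt⟩ := domain_mvt hderiv hs hx hy
  rw [← inner_sub_right] at hmvt
  rw [real_inner_comm, hmvt, ContinuousLinearMap.comp_apply, innerSL_apply_apply, real_inner_comm]
  exact hm z (hs.segment_subset hx hy hz) _

theorem mul_norm_sub_le_of_hasFDerivWithinAt {s : Set V} (hs : Convex ℝ s) {T : V → V}
    {T' : V → V →L[ℝ] V} {m : ℝ} (hT : ∀ x ∈ s, HasFDerivWithinAt T (T' x) s x)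
    (hm : ∀ x ∈ s, ∀ v, m * ‖v‖ ^ 2 ≤ inner ℝ (T' x v) v) {x y : V} (hx : x ∈ s) (hy : y ∈ s) :
    m * ‖x - y‖ ≤ ‖T x - T y‖ := by
  rcases eq_or_ne x y with rfl | hxy
  · simp
  · refine le_of_mul_le_mul_right ?_ (norm_pos_iff.2 (sub_ne_zero.2 hxy))
    calc m * ‖x - y‖ * ‖x - y‖ = m * ‖x - y‖ ^ 2 := by ring
      _ ≤ inner ℝ (T x - T y) (x - y) := le_inner_sub_of_hasFDerivWithinAt hs hT hm hy hx
      _ ≤ ‖T x - T y‖ * ‖x - y‖ := real_inner_le_norm _ _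

theorem inner_sub_le_of_hasGradientWithinAt [CompleteSpace V] {s : Set V} (hs : Convex ℝ s)
    {f : V → ℝ} {T : V → V} (hf : ∀ x ∈ s, HasGradientWithinAt f (T x) s x)
    (hmono : ∀ x ∈ s, ∀ y ∈ s, 0 ≤ inner ℝ (T y - T x) (y - x)) {x y : V} (hx : x ∈ s)
    (hy : y ∈ s) : inner ℝ (T x) (y - x) ≤ f y - f x := by
  obtain ⟨z, hz, hmvt⟩ := domain_mvt (fun x hx => (hf x hx).hasFDerivWithinAt) hs hx hy
  rw [hmvt, InnerProductSpace.toDual_apply_apply, ← sub_nonneg, ← inner_sub_left]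
  obtain ⟨r, hr, rfl⟩ := (segment_eq_image' ℝ x y).subset hz
  rcases hr.1.eq_or_lt with rfl | hr0
  · simp
  · have := hmono x hx _ (hs.segment_subset hx hy hz)
    rw [add_sub_cancel_left, inner_smul_right] at this
    exact nonneg_of_mul_nonneg_right this hr0

variable [FiniteDimensional ℝ V]

theorem det_ne_zero_of_inner_pos {A : V →L[ℝ] V} (hA : ∀ v ≠ 0, 0 < inner ℝ (A v) v) :
    A.det ≠ 0 := by
  intro hdet
  obtain ⟨v, hv, hv0⟩ := (Submodule.ne_bot_iff _).1
    (LinearMap.bot_lt_ker_of_det_eq_zero hdet).ne'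
  have hAv : A v = 0 := hv
  simpa [hAv] using hA v hv0

theorem isInvertible_of_inner_pos {A : V →L[ℝ] V} (hA : ∀ v ≠ 0, 0 < inner ℝ (A v) v) :
    A.IsInvertible :=
  ⟨A.toContinuousLinearEquivOfDetNeZero (det_ne_zero_of_inner_pos hA),
    A.coe_toContinuousLinearEquivOfDetNeZero _⟩

theorem det_pos_of_inner_pos {A : V →L[ℝ] V} (hA : ∀ v ≠ 0, 0 < inner ℝ (A v) v) :
    0 < A.det := by
  let γ (t : ℝ) : V →L[ℝ] V := (1 - t) • .id ℝ V + t • A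
  have hγ : ∀ t ∈ Icc (0 : ℝ) 1, ∀ v ≠ 0, 0 < inner ℝ (γ t v) v := by
    intro t ht v hv
    have hinner : inner ℝ (γ t v) v = (1 - t) * ‖v‖ ^ 2 + t * inner ℝ (A v) v := by
      simp [γ, inner_add_left, inner_smul_left]
    have hv' : 0 < ‖v‖ ^ 2 := by positivity
    rcases ht.1.eq_or_lt with rfl | ht0
    · simpa [hinner] using hv'
    · have := mul_nonneg (sub_nonneg.2 ht.2) hv'.le
      have := mul_pos ht0 (hA v hv)
      linarith
  have hcont : ContinuousOn (fun t => (γ t).det) (Icc 0 1) :=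
    (ContinuousLinearMap.continuous_det.comp (by fun_prop)).continuousOn
  have hγ0 : (γ 0).det = 1 := by simp [γ, ContinuousLinearMap.det]
  have hγ1 : γ 1 = A := by simp [γ]
  by_contra! hle
  obtain ⟨t, ht, hzero⟩ := intermediate_value_Icc' zero_le_one hcont
    (show (0 : ℝ) ∈ Icc (γ 1).det (γ 0).det from ⟨hγ1 ▸ hle, hγ0 ▸ zero_le_one⟩)
  exact det_ne_zero_of_inner_pos (hγ t ht) hzero

theorem exists_pos_mul_sq_le_inner_of_isCompact {Z : Type*} [TopologicalSpace Z] {C : Set Z}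
    (hC : IsCompact C) {A : Z → V →L[ℝ] V} (hA : ContinuousOn A C)
    (hpos : ∀ z ∈ C, ∀ v ≠ 0, 0 < inner ℝ (A z v) v) :
    ∃ m > 0, ∀ z ∈ C, ∀ v, m * ‖v‖ ^ 2 ≤ inner ℝ (A z v) v := by
  have hcont : ContinuousOn (fun z : Z × V => inner ℝ (A z.1 z.2) z.2)
      (C ×ˢ Metric.sphere (0 : V) 1) :=
    ((hA.comp continuousOn_fst fun z hz => hz.1).clm_apply continuousOn_snd).inner continuousOn_snd
  obtain ⟨m, hm, hle⟩ := (hC.prod (isCompact_sphere 0 1)).exists_forall_le' hcont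
    (a := 0) fun z hz => hpos z.1 hz.1 z.2 (Metric.ne_of_mem_sphere hz.2 one_ne_zero)
  refine ⟨m, hm, fun z hz v => ?_⟩
  rcases eq_or_ne v 0 with rfl | hv
  · simp
  · have hv' : ‖v‖ ≠ 0 := norm_ne_zero_iff.2 hv
    have hunit := hle (z, ‖v‖⁻¹ • v) ⟨hz, by simp [norm_smul, hv']⟩
    simp only [map_smul, inner_smul_left, inner_smul_right, conj_trivial, ← mul_assoc] at hunit
    calc m * ‖v‖ ^ 2 ≤ ‖v‖⁻¹ * ‖v‖⁻¹ * inner ℝ (A z v) v * ‖v‖ ^ 2 := by gcongr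
      _ = inner ℝ (A z v) v := by field_simp

end InnerProductSpace

theorem existsUnique_vadd_mem_image {G α : Type*} [VAdd G α] {T : α → α}
    (hT : Function.Bijective T) (hequiv : ∀ (g : G) x, T (g +ᵥ x) = g +ᵥ T x) {s : Set α}
    (hs : ∀ x, ∃! g : G, g +ᵥ x ∈ s) (y : α) : ∃! g : G, g +ᵥ y ∈ T '' s := by
  obtain ⟨x, rfl⟩ := hT.surjective y
  simpa only [← hequiv, hT.injective.mem_set_image] using hs x

namespace SampleSpace

variable {d : ℕ} {S : SampleSpace d}

section Geometry

theorem convex_carrier (S : SampleSpace d) : Convex ℝ S.carrier := by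
  cases S with
  | body Ω hc hv hi => exact hv
  | torus => exact convex_univ

theorem isClosed_carrier (S : SampleSpace d) : IsClosed S.carrier := by
  cases S with
  | body Ω hc hv hi => exact hc.isClosed
  | torus => exact isClosed_univ

theorem cell_subset_carrier (S : SampleSpace d) : S.cell ⊆ S.carrier := by
  cases S with
  | body Ω hc hv hi => exact Subset.rfl
  | torus => exact subset_univ _

theorem closure_cell_subset_carrier (S : SampleSpace d) : closure S.cell ⊆ S.carrier :=
  closure_minimal S.cell_subset_carrier S.isClosed_carrier

theorem cell_torus : (torus : SampleSpace d).cell =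
    ZSpan.fundamentalDomain (EuclideanSpace.basisFun (Fin d) ℝ).toBasis := by
  ext x
  simp [cell, ZSpan.mem_fundamentalDomain]

theorem mem_periods_torus {v : E d} : v ∈ (torus : SampleSpace d).periods ↔
    v ∈ Submodule.span ℤ (range (EuclideanSpace.basisFun (Fin d) ℝ).toBasis) := by
  rw [Module.Basis.mem_span_iff_repr_mem ℤ]
  simp [periods, eq_comm]

theorem measurableSet_cell (S : SampleSpace d) : MeasurableSet S.cell := by
  cases S with
  | body Ω hc hv hi => exact hc.measurableSet
  | torus => exact cell_torus ▸ ZSpan.fundamentalDomain_measurableSet _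

theorem isBounded_cell (S : SampleSpace d) : Bornology.IsBounded S.cell := by
  cases S with
  | body Ω hc hv hi => exact hc.isBounded
  | torus => exact cell_torus ▸ ZSpan.fundamentalDomain_isBounded _

theorem isCompact_closure_cell (S : SampleSpace d) : IsCompact (closure S.cell) :=
  S.isBounded_cell.isCompact_closure

theorem convex_cell (S : SampleSpace d) : Convex ℝ S.cell := by
  cases S with
  | body Ω hc hv hi => exact hv
  | torus => exact fun x hx y hy a b ha hb hab i => convex_Ico 0 1 (hx i) (hy i) ha hb hab

theorem interior_cell_nonempty (S : SampleSpace d) : (interior S.cell).Nonempty := by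
  cases S with
  | body Ω hc hv hi => exact hi
  | torus =>
    have hopen : IsOpen {x : E d | ∀ i, x i ∈ Ioo (0 : ℝ) 1} := by
      rw [ofPred_forall]
      exact isOpen_iInter_of_finite fun i =>
        isOpen_Ioo.preimage (EuclideanSpace.proj (𝕜 := ℝ) i).continuous
    have hsub : {x : E d | ∀ i, x i ∈ Ioo (0 : ℝ) 1} ⊆ (torus : SampleSpace d).cell :=
      fun x hx i => Ioo_subset_Ico_self (hx i)
    refine ⟨WithLp.toLp 2 fun _ => 1 / 2, interior_maximal hsub hopen fun i => ?_⟩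
    norm_num

theorem volume_cell_lt_top (S : SampleSpace d) : volume S.cell < ⊤ :=
  S.isBounded_cell.measure_lt_top

theorem uniqueDiffOn_carrier (S : SampleSpace d) : UniqueDiffOn ℝ S.carrier :=
  uniqueDiffOn_convex S.convex_carrier
    (S.interior_cell_nonempty.mono (interior_mono S.cell_subset_carrier))

theorem vadd_carrier {v : E d} (hv : v ∈ S.periods) : v +ᵥ S.carrier = S.carrier := by
  cases S with
  | body Ω hc hcv hi => rw [show v = 0 from hv, zero_vadd]
  | torus => exact vadd_set_univ

theorem add_mem_carrier_iff {v : E d} (hv : v ∈ S.periods) {x : E d} :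
    x + v ∈ S.carrier ↔ x ∈ S.carrier := by
  nth_rewrite 1 [← vadd_carrier hv]
  rw [add_comm, ← vadd_eq_add, vadd_mem_vadd_set_iff]

theorem exists_add_mem_cell {x : E d} (hx : x ∈ S.carrier) :
    ∃ v ∈ S.periods, x + v ∈ S.cell := by
  cases S with
  | body Ω hc hv hi => exact ⟨0, rfl, by rwa [add_zero]⟩
  | torus =>
    obtain ⟨v, hv, -⟩ := ZSpan.exist_unique_vadd_mem_fundamentalDomain
      (EuclideanSpace.basisFun (Fin d) ℝ).toBasis x
    exact ⟨v, mem_periods_torus.2 v.2, by rwa [cell_torus, add_comm]⟩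

theorem setIntegral_image_cell {T : E d → E d} (hT : ContinuousOn T S.carrier)
    (hbij : BijOn T S.carrier S.carrier)
    (hper : ∀ v ∈ S.periods, ∀ x ∈ S.carrier, T (x + v) = T x + v) {f : E d → ℝ}
    (hf : ∀ v ∈ S.periods, ∀ x, f (x + v) = f x) :
    ∫ x in T '' S.cell, f x = S.integral f := by
  cases S with
  | body Ω hc hv hi => exact congr(∫ x in $hbij.image_eq, f x)
  | torus =>
    let b := (EuclideanSpace.basisFun (Fin d) ℝ).toBasis
    have : VAddInvariantMeasure (Submodule.span ℤ (range b)) (E d) volume :=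
      ⟨fun c s _ => measure_preimage_add volume (c : E d) s⟩
    have hvadd (v : Submodule.span ℤ (range b)) (x : E d) : v +ᵥ x = x + v := add_comm _ _
    have himage : IsAddFundamentalDomain (Submodule.span ℤ (range b))
        (T '' (torus : SampleSpace d).cell) volume := by
      refine .mk' ((measurableSet_cell _).image_of_continuousOn_injOn (hT.mono (subset_univ _))
        (hbij.injOn.mono (subset_univ _))).nullMeasurableSet
        (existsUnique_vadd_mem_image (bijOn_univ.1 hbij) (fun v x => ?_) fun x => ?_)
      · rw [hvadd, hvadd, hper v (mem_periods_torus.2 v.2) x (mem_univ x)]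
      · exact cell_torus (d := d) ▸ ZSpan.exist_unique_vadd_mem_fundamentalDomain b x
    refine himage.setIntegral_eq (cell_torus (d := d) ▸ ZSpan.isAddFundamentalDomain b volume)
      fun v x => ?_
    rw [hvadd, hf v (mem_periods_torus.2 v.2)]

end Geometry

section Smooth

theorem eqOn_zero_of_ae_eq_zero_cell {f : E d → ℝ} (hf : f ∈ S.smooth)
    (hzero : f =ᵐ[volume.restrict S.cell] 0) : EqOn f 0 S.carrier := by
  have hclosure : S.cell ⊆ closure (interior S.cell) := by
    rw [S.convex_cell.closure_interior_eq_closure_of_nonempty_interior S.interior_cell_nonempty]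
    exact subset_closure
  have hcell : EqOn f 0 S.cell := Measure.eqOn_of_ae_eq hzero
    (hf.1.continuousOn.mono S.cell_subset_carrier) continuousOn_const hclosure
  intro x hx
  obtain ⟨v, hv, hxv⟩ := exists_add_mem_cell hx
  rw [← hf.2 v hv x]
  exact hcell hxv

theorem quad_add (x v : E d) : quad (x + v) = quad x + (inner ℝ v x + quad v) := by
  rw [quad, quad, quad, norm_add_sq_real, real_inner_comm]
  ring

theorem contDiff_quad {n : WithTop ℕ∞} : ContDiff ℝ n (quad : E d → ℝ) :=
  (contDiff_norm_sq ℝ).div_const 2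

theorem contDiffOn_of_mem_potentials {Φ : E d → ℝ} (hΦ : Φ ∈ S.potentials) :
    ContDiffOn ℝ ∞ Φ S.carrier := by
  cases S with
  | body Ω hc hv hi => exact hΦ
  | torus => simpa using! hΦ.1.add contDiff_quad.contDiffOn

theorem potential_add_period {Φ : E d → ℝ} (hΦ : Φ ∈ S.potentials) {v : E d}
    (hv : v ∈ S.periods) (x : E d) : Φ (x + v) = Φ x + (inner ℝ v x + quad v) := by
  cases S with
  | body Ω hc hcv hi => simp [show v = 0 from hv, quad]
  | torus =>
    have hper : Φ (x + v) - quad (x + v) = Φ x - quad x := hΦ.2 v hv x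
    rw [quad_add] at hper
    linarith

theorem sub_mem_smooth {Φ Ψ : E d → ℝ} (hΦ : Φ ∈ S.potentials) (hΨ : Ψ ∈ S.potentials) :
    Φ - Ψ ∈ S.smooth := by
  refine ⟨(contDiffOn_of_mem_potentials hΦ).sub (contDiffOn_of_mem_potentials hΨ), ?_⟩
  intro v hv x
  simp only [Pi.sub_apply, potential_add_period hΦ hv, potential_add_period hΨ hv,
    add_sub_add_right_eq_sub]

end Smooth

section Gradient

variable {f g : E d → ℝ} {x : E d}

theorem hasGradientWithinAt_grad (hf : DifferentiableWithinAt ℝ f S.carrier x) :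
    HasGradientWithinAt f (S.grad f x) S.carrier x :=
  hf.hasGradientWithinAt

theorem grad_eq_of_hasGradientWithinAt {w : E d} (hx : x ∈ S.carrier)
    (hf : HasGradientWithinAt f w S.carrier x) : S.grad f x = w := by
  rw [grad, gradientWithin, hf.hasFDerivWithinAt.fderivWithin (S.uniqueDiffOn_carrier x hx)]
  exact LinearIsometryEquiv.symm_apply_apply _ w

theorem grad_congr (hfg : EqOn f g S.carrier) (hx : x ∈ S.carrier) : S.grad f x = S.grad g x := by
  rw [grad, grad, gradientWithin, gradientWithin, fderivWithin_congr hfg (hfg hx)]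

theorem grad_add_const (f : E d → ℝ) (a : ℝ) : S.grad (fun x => f x + a) = S.grad f := by
  funext x
  simp only [grad, gradientWithin, fderivWithin_add_const]

theorem grad_sub (hx : x ∈ S.carrier) (hf : DifferentiableWithinAt ℝ f S.carrier x)
    (hg : DifferentiableWithinAt ℝ g S.carrier x) :
    S.grad (f - g) x = S.grad f x - S.grad g x := by
  refine grad_eq_of_hasGradientWithinAt hx ?_
  rw [hasGradientWithinAt_iff_hasFDerivWithinAt, map_sub]
  exact (hasGradientWithinAt_grad hf).hasFDerivWithinAt.sub
    (hasGradientWithinAt_grad hg).hasFDerivWithinAt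

theorem grad_add_smul (hx : x ∈ S.carrier) (hf : DifferentiableWithinAt ℝ f S.carrier x)
    (hg : DifferentiableWithinAt ℝ g S.carrier x) (t : ℝ) :
    S.grad (f + t • g) x = S.grad f x + t • S.grad g x := by
  refine grad_eq_of_hasGradientWithinAt hx ?_
  rw [hasGradientWithinAt_iff_hasFDerivWithinAt, map_add, map_smul]
  exact (hasGradientWithinAt_grad hf).hasFDerivWithinAt.add
    ((hasGradientWithinAt_grad hg).hasFDerivWithinAt.const_smul t)

theorem contDiffOn_grad (hf : ContDiffOn ℝ ∞ f S.carrier) :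
    ContDiffOn ℝ ∞ (S.grad f) S.carrier :=
  (InnerProductSpace.toDual ℝ (E d)).symm.toContinuousLinearEquiv.contDiff.comp_contDiffOn
    (hf.fderivWithin S.uniqueDiffOn_carrier (by simp))

theorem hasFDerivWithinAt_grad (hf : ContDiffOn ℝ ∞ f S.carrier) (hx : x ∈ S.carrier) :
    HasFDerivWithinAt (S.grad f) (S.hess f x) S.carrier x :=
  ((contDiffOn_grad hf).differentiableOn (by simp) x hx).hasFDerivWithinAt

theorem hasGradientWithinAt_quad (s : Set (E d)) (x : E d) : HasGradientWithinAt quad x s x := by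
  have hsq := (hasStrictFDerivAt_norm_sq x).hasFDerivAt.hasFDerivWithinAt (s := s)
    |>.mul_const (2⁻¹ : ℝ)
  refine hasGradientWithinAt_iff_hasFDerivWithinAt.2 (hsq.congr_fderiv ?_)
  ext v
  simp

theorem grad_quad (hx : x ∈ S.carrier) : S.grad quad x = x :=
  grad_eq_of_hasGradientWithinAt hx (hasGradientWithinAt_quad _ x)

theorem hess_quad (hx : x ∈ S.carrier) : S.hess quad x = .id ℝ (E d) :=
  ((hasFDerivWithinAt_id x _).congr (fun _ hy => grad_quad hy) (grad_quad hx)).fderivWithin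
    (S.uniqueDiffOn_carrier x hx)

theorem grad_add_period {Φ : E d → ℝ} (hΦ : Φ ∈ S.potentials) {v : E d} (hv : v ∈ S.periods)
    (hx : x ∈ S.carrier) : S.grad Φ (x + v) = S.grad Φ x + v := by
  have hd := (contDiffOn_of_mem_potentials hΦ).differentiableOn (by simp)
  have hshift : HasFDerivWithinAt (fun y => Φ (y + v))
      (InnerProductSpace.toDual ℝ _ (S.grad Φ (x + v))) S.carrier x := by
    rw [hasFDerivWithinAt_comp_add_right, vadd_carrier hv]
    exact hasGradientWithinAt_grad (hd _ ((add_mem_carrier_iff hv).2 hx))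
  have hadd : HasFDerivWithinAt (fun y => Φ y + (inner ℝ v y + quad v))
      (InnerProductSpace.toDual ℝ _ (S.grad Φ x + v)) S.carrier x := by
    rw [map_add]
    exact (hasGradientWithinAt_grad (hd x hx)).hasFDerivWithinAt.add
      ((innerSL ℝ v).hasFDerivWithinAt.add_const _)
  simp only [potential_add_period hΦ hv] at hshift
  exact (InnerProductSpace.toDual ℝ (E d)).injective
    ((S.uniqueDiffOn_carrier x hx).eq hshift hadd)

theorem hess_add_period {Φ : E d → ℝ} (hΦ : Φ ∈ S.potentials) {v : E d} (hv : v ∈ S.periods)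
    (hx : x ∈ S.carrier) : S.hess Φ (x + v) = S.hess Φ x :=
  calc S.hess Φ (x + v) = fderivWithin ℝ (fun y => S.grad Φ (y + v)) S.carrier x := by
        rw [fderivWithin_comp_add_right, vadd_carrier hv, hess]
    _ = fderivWithin ℝ (fun y => S.grad Φ y + v) S.carrier x :=
        fderivWithin_congr (fun y hy => grad_add_period hΦ hv hy) (grad_add_period hΦ hv hx)
    _ = S.hess Φ x := fderivWithin_add_const v

end Gradient

section Push

variable {Φ f q : E d → ℝ} {x y : E d}

/-- The inverse `(∇Φ)⁻¹` of the transport map of a transport coordinate. -/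
noncomputable def gradInv (S : SampleSpace d) (Φ : E d → ℝ) : E d → E d :=
  Function.invFunOn (S.grad Φ) S.carrier

theorem mapsTo_gradInv (hΦ : Φ ∈ S.coords) : MapsTo (S.gradInv Φ) S.carrier S.carrier :=
  fun _ hy => Function.invFunOn_mem (hΦ.2.2.surjOn hy)

theorem rightInvOn_gradInv (hΦ : Φ ∈ S.coords) : RightInvOn (S.gradInv Φ) (S.grad Φ) S.carrier :=
  hΦ.2.2.surjOn.rightInvOn_invFunOn

theorem leftInvOn_gradInv (hΦ : Φ ∈ S.coords) : LeftInvOn (S.gradInv Φ) (S.grad Φ) S.carrier :=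
  hΦ.2.2.injOn.leftInvOn_invFunOn

theorem contDiffOn_of_mem_coords (hΦ : Φ ∈ S.coords) : ContDiffOn ℝ ∞ Φ S.carrier :=
  contDiffOn_of_mem_potentials hΦ.1

theorem det_hess_pos (hΦ : Φ ∈ S.coords) (hx : x ∈ S.carrier) : 0 < (S.hess Φ x).det :=
  det_pos_of_inner_pos (hΦ.2.1 x hx)

theorem push_of_mem (Φ q : E d → ℝ) (hy : y ∈ S.carrier) :
    S.push Φ q y = q (S.gradInv Φ y) / (S.hess Φ (S.gradInv Φ y)).det := if_pos hy

theorem push_of_notMem (Φ q : E d → ℝ) (hy : y ∉ S.carrier) : S.push Φ q y = 0 := if_neg hy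

theorem push_eq_of_isPush {p : E d → ℝ} (hΦ : Φ ∈ S.coords) (hp : ∀ x, x ∉ S.carrier → p x = 0)
    (hpush : S.IsPush Φ q p) : S.push Φ q = p := by
  funext y
  by_cases hy : y ∈ S.carrier
  · have hx := mapsTo_gradInv hΦ hy
    rw [push_of_mem _ _ hy, div_eq_iff (det_hess_pos hΦ hx).ne', ← hpush _ hx,
      rightInvOn_gradInv hΦ hy]
  · rw [push_of_notMem _ _ hy, hp y hy]

theorem push_quad (hquad : quad ∈ S.coords) (hq : ∀ x, x ∉ S.carrier → q x = 0) :
    S.push quad q = q :=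
  push_eq_of_isPush hquad hq fun x hx => by
    rw [grad_quad hx, hess_quad hx, ContinuousLinearMap.det, ContinuousLinearMap.coe_id,
      LinearMap.det_id, mul_one]

theorem push_add_const (Φ q : E d → ℝ) (a : ℝ) : S.push (fun x => Φ x + a) q = S.push Φ q := by
  unfold push hess
  rw [grad_add_const]

theorem gradInv_add_period (hΦ : Φ ∈ S.coords) {v : E d} (hv : v ∈ S.periods)
    (hy : y ∈ S.carrier) : S.gradInv Φ (y + v) = S.gradInv Φ y + v := by
  have hx := mapsTo_gradInv hΦ hy
  have hgrad : S.grad Φ (S.gradInv Φ y + v) = y + v := by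
    rw [grad_add_period hΦ.1 hv hx, rightInvOn_gradInv hΦ hy]
  rw [← hgrad, leftInvOn_gradInv hΦ ((add_mem_carrier_iff hv).2 hx)]

theorem push_add_period (hΦ : Φ ∈ S.coords) (hq : ∀ v ∈ S.periods, ∀ x, q (x + v) = q x)
    {v : E d} (hv : v ∈ S.periods) (y : E d) : S.push Φ q (y + v) = S.push Φ q y := by
  by_cases hy : y ∈ S.carrier
  · rw [push_of_mem _ _ ((add_mem_carrier_iff hv).2 hy), push_of_mem _ _ hy,
      gradInv_add_period hΦ hv hy, hq v hv, hess_add_period hΦ.1 hv (mapsTo_gradInv hΦ hy)]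
  · rw [push_of_notMem _ _ hy, push_of_notMem _ _ ((add_mem_carrier_iff hv).not.2 hy)]

theorem push_nonneg (hΦ : Φ ∈ S.coords) (hq : ∀ x, 0 ≤ q x) (y : E d) : 0 ≤ S.push Φ q y := by
  by_cases hy : y ∈ S.carrier
  · rw [push_of_mem _ _ hy]
    exact div_nonneg (hq _) (det_hess_pos hΦ (mapsTo_gradInv hΦ hy)).le
  · rw [push_of_notMem _ _ hy]

theorem integral_mul_push (hΦ : Φ ∈ S.coords) (hq : ∀ v ∈ S.periods, ∀ x, q (x + v) = q x)
    (hf : ∀ v ∈ S.periods, ∀ x, f (x + v) = f x) :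
    (S.integral fun y => f y * S.push Φ q y) = S.integral fun x => f (S.grad Φ x) * q x := by
  have hc := contDiffOn_of_mem_coords hΦ
  have hsub := S.cell_subset_carrier
  calc (S.integral fun y => f y * S.push Φ q y)
      = ∫ y in S.grad Φ '' S.cell, f y * S.push Φ q y :=
        (setIntegral_image_cell (contDiffOn_grad hc).continuousOn hΦ.2.2
          (fun v hv x hx => grad_add_period hΦ.1 hv hx)
          fun v hv x => by rw [hf v hv, push_add_period hΦ hq hv]).symm
    _ = ∫ x in S.cell, |(S.hess Φ x).det| • (f (S.grad Φ x) * S.push Φ q (S.grad Φ x)) :=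
        integral_image_eq_integral_abs_det_fderiv_smul volume S.measurableSet_cell
          (fun x hx => (hasFDerivWithinAt_grad hc (hsub hx)).mono hsub) (hΦ.2.2.injOn.mono hsub) _
    _ = S.integral fun x => f (S.grad Φ x) * q x :=
        setIntegral_congr_fun S.measurableSet_cell fun x hx => by
          rw [← S.isPush_push hΦ q x (hsub hx), abs_of_pos (det_hess_pos hΦ (hsub hx)), smul_eq_mul]
          ring

end Push

section SmoothCurve

variable {dom : Set (E d → ℝ)} {c Φ : ℝ → E d → ℝ} {f g h q ξ : E d → ℝ}

/-- The curves `(c_t)`, `0 ≤ t ≤ 1`, in a set `dom` of functions along which first variations are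
tested: `c_t(x)` is smooth in `(t, x)`, up to the boundary. -/
structure IsSmoothCurve (S : SampleSpace d) (dom : Set (E d → ℝ)) (c : ℝ → E d → ℝ) : Prop where
  contDiffOn : ContDiffOn ℝ ∞ (fun z : ℝ × E d => c z.1 z.2) (Icc 0 1 ×ˢ S.carrier)
  mem : ∀ t ∈ Icc (0 : ℝ) 1, c t ∈ dom

theorem IsFirstVariation.hasDerivWithinAt {G : (E d → ℝ) → ℝ} (hg : S.IsFirstVariation dom G f g)
    (hc : S.IsSmoothCurve dom c) (hc₀ : c 0 = f) :
    HasDerivWithinAt (fun t => G (c t))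
      (S.integral fun x => g x * derivWithin (fun t => c t x) (Icc 0 1) 0) (Icc 0 1) 0 :=
  hg.2 c hc.contDiffOn hc.mem hc₀

theorem isSmoothCurve_add_smul (hf : ContDiffOn ℝ ∞ f S.carrier)
    (hg : ContDiffOn ℝ ∞ g S.carrier) (hmem : ∀ t ∈ Icc (0 : ℝ) 1, f + t • g ∈ dom) :
    S.IsSmoothCurve dom fun t => f + t • g :=
  ⟨(hf.comp contDiffOn_snd fun _ hz => hz.2).add
    (contDiffOn_fst.mul (hg.comp contDiffOn_snd fun _ hz => hz.2)), hmem⟩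

theorem IsFirstVariation.hasDerivWithinAt_add_smul {G : (E d → ℝ) → ℝ}
    (hg : S.IsFirstVariation dom G f g) (hh : S.IsSmoothCurve dom fun t => f + t • h) :
    HasDerivWithinAt (fun t : ℝ => G (f + t • h)) (S.integral fun x => g x * h x)
      (Icc 0 1) 0 := by
  have hderiv (x : E d) : derivWithin (fun t : ℝ => (f + t • h) x) (Icc 0 1) 0 = h x :=
    (hasDerivWithinAt_const_add_smul (f x) (h x) _ 0).derivWithin
      (uniqueDiffOn_Icc_zero_one 0 unitInterval.zero_mem)
  simpa only [hderiv] using hg.hasDerivWithinAt hh (by rw [zero_smul, add_zero])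

theorem hasDerivWithinAt_integral
    (hc : ContDiffOn ℝ 1 (fun z : ℝ × E d => c z.1 z.2) (Icc 0 1 ×ˢ S.carrier)) :
    HasDerivWithinAt (fun t => S.integral (c t))
      (S.integral fun x => derivWithin (fun t => c t x) (Icc 0 1) 0) (Icc 0 1) 0 :=
  hasDerivWithinAt_setIntegral_of_contDiffOn S.uniqueDiffOn_carrier S.measurableSet_cell
    S.isCompact_closure_cell S.closure_cell_subset_carrier zero_lt_one unitInterval.zero_mem hc

theorem contDiffOn_grad_slice
    (hΦ : ContDiffOn ℝ ∞ (fun z : ℝ × E d => Φ z.1 z.2) (Icc 0 1 ×ˢ S.carrier)) :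
    ContDiffOn ℝ ∞ (fun z : ℝ × E d => S.grad (Φ z.1) z.2) (Icc 0 1 ×ˢ S.carrier) :=
  (InnerProductSpace.toDual ℝ (E d)).symm.toContinuousLinearEquiv.contDiff.comp_contDiffOn
    (contDiffOn_fderivWithin_slice (by simp) S.uniqueDiffOn_carrier hΦ)

theorem contDiffOn_hess_slice
    (hΦ : ContDiffOn ℝ ∞ (fun z : ℝ × E d => Φ z.1 z.2) (Icc 0 1 ×ˢ S.carrier)) :
    ContDiffOn ℝ ∞ (fun z : ℝ × E d => S.hess (Φ z.1) z.2) (Icc 0 1 ×ˢ S.carrier) :=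
  contDiffOn_fderivWithin_slice (f := fun t => S.grad (Φ t)) (by simp) S.uniqueDiffOn_carrier
    (contDiffOn_grad_slice hΦ)

theorem IsSmoothCurve.exists_pos_mul_sq_le_inner_hess (hΦ : S.IsSmoothCurve S.coords Φ) :
    ∃ m > 0, ∀ t ∈ Icc (0 : ℝ) 1, ∀ x ∈ S.carrier, ∀ v : E d,
      m * ‖v‖ ^ 2 ≤ inner ℝ (S.hess (Φ t) x v) v := by
  obtain ⟨m, hm, hle⟩ := exists_pos_mul_sq_le_inner_of_isCompact
    (isCompact_Icc.prod S.isCompact_closure_cell)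
    ((contDiffOn_hess_slice hΦ.contDiffOn).continuousOn.mono
      (prod_mono_right S.closure_cell_subset_carrier))
    fun z hz => (hΦ.mem z.1 hz.1).2.1 z.2 (S.closure_cell_subset_carrier hz.2)
  refine ⟨m, hm, fun t ht x hx v => ?_⟩
  obtain ⟨p, hp, hxp⟩ := exists_add_mem_cell hx
  rw [← hess_add_period (hΦ.mem t ht).1 hp hx]
  exact hle (t, x + p) ⟨ht, subset_closure hxp⟩ v

theorem IsSmoothCurve.contDiffOn_gradInv (hΦ : S.IsSmoothCurve S.coords Φ) :
    ContDiffOn ℝ ∞ (fun z : ℝ × E d => S.gradInv (Φ z.1) z.2) (Icc 0 1 ×ˢ S.carrier) := by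
  obtain ⟨m, hm, hle⟩ := hΦ.exists_pos_mul_sq_le_inner_hess
  exact contDiffOn_of_parametric_rightInverse (f := fun t => S.grad (Φ t)) (n := ⊤) (by simp) hm
    uniqueDiffOn_Icc_zero_one S.uniqueDiffOn_carrier S.uniqueDiffOn_carrier
    (contDiffOn_grad_slice hΦ.contDiffOn) (fun t ht => mapsTo_gradInv (hΦ.mem t ht))
    (fun t ht => rightInvOn_gradInv (hΦ.mem t ht))
    (fun t ht x hx y hy => mul_norm_sub_le_of_hasFDerivWithinAt S.convex_carrier
      (fun z hz => hasFDerivWithinAt_grad (contDiffOn_of_mem_coords (hΦ.mem t ht)) hz)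
      (hle t ht) hx hy)
    fun t ht x hx => isInvertible_of_inner_pos ((hΦ.mem t ht).2.1 x hx)

theorem IsSmoothCurve.contDiffOn_push (hΦ : S.IsSmoothCurve S.coords Φ)
    (hq : ContDiffOn ℝ ∞ q S.carrier) :
    ContDiffOn ℝ ∞ (fun z : ℝ × E d => S.push (Φ z.1) q z.2) (Icc 0 1 ×ˢ S.carrier) := by
  have hinv := hΦ.contDiffOn_gradInv
  have hmaps : ∀ z ∈ Icc (0 : ℝ) 1 ×ˢ S.carrier, S.gradInv (Φ z.1) z.2 ∈ S.carrier :=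
    fun z hz => mapsTo_gradInv (hΦ.mem z.1 hz.1) hz.2
  have hdet : ContDiffOn ℝ ∞ (fun z : ℝ × E d => (S.hess (Φ z.1) (S.gradInv (Φ z.1) z.2)).det)
      (Icc 0 1 ×ˢ S.carrier) :=
    contDiff_continuousLinearMap_det.comp_contDiffOn
      ((contDiffOn_hess_slice hΦ.contDiffOn).comp (contDiffOn_fst.prodMk hinv)
        fun z hz => ⟨hz.1, hmaps z hz⟩)
  exact ((hq.comp hinv hmaps).div hdet fun z hz =>
    (det_hess_pos (hΦ.mem z.1 hz.1) (hmaps z hz)).ne').congr fun z hz => push_of_mem _ _ hz.2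

theorem IsSmoothCurve.push (hΦ : S.IsSmoothCurve S.coords Φ) (hq : q ∈ S.densities) :
    S.IsSmoothCurve S.densities fun t => S.push (Φ t) q := by
  have hsmooth := hΦ.contDiffOn_push hq.1.1
  refine ⟨hsmooth, fun t ht => ⟨⟨?_, fun v hv => push_add_period (hΦ.mem t ht) hq.1.2 hv⟩,
    push_nonneg (hΦ.mem t ht) hq.2.1, fun _ => push_of_notMem _ _, ?_⟩⟩
  · exact hsmooth.comp (f := fun x => (t, x)) (by fun_prop) fun _ hx => ⟨ht, hx⟩
  · simpa only [Pi.one_apply, one_mul, hq.2.2.2] using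
      integral_mul_push (f := 1) (hΦ.mem t ht) hq.1.2 fun _ _ _ => rfl

theorem IsSmoothCurve.hasDerivWithinAt_integral_mul (hc : S.IsSmoothCurve dom c)
    (hf : ContDiffOn ℝ ∞ f S.carrier) :
    HasDerivWithinAt (fun t => S.integral fun x => f x * c t x)
      (S.integral fun x => f x * derivWithin (fun t => c t x) (Icc 0 1) 0) (Icc 0 1) 0 := by
  have hderiv : (S.integral fun x => derivWithin (fun t => f x * c t x) (Icc 0 1) 0) =
      S.integral fun x => f x * derivWithin (fun t => c t x) (Icc 0 1) 0 :=
    setIntegral_congr_fun S.measurableSet_cell fun x hx =>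
      derivWithin_const_mul _ (differentiableOn_slice_left (S.cell_subset_carrier hx)
        (hc.contDiffOn.differentiableOn (by simp)) 0 unitInterval.zero_mem)
  rw [← hderiv]
  exact hasDerivWithinAt_integral
    (((hf.comp contDiffOn_snd fun _ hz => hz.2).mul hc.contDiffOn).of_le (by simp))

theorem IsSmoothCurve.hasDerivWithinAt_integral_comp_grad_mul
    (hΦ : S.IsSmoothCurve S.coords Φ) (hξ : ContDiffOn ℝ ∞ ξ S.carrier)
    (hq : ContDiffOn ℝ ∞ q S.carrier) :
    HasDerivWithinAt (fun t => S.integral fun x => ξ (S.grad (Φ t) x) * q x)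
      (S.integral fun x => inner ℝ (S.grad ξ (S.grad (Φ 0) x))
        (derivWithin (fun t => S.grad (Φ t) x) (Icc 0 1) 0) * q x) (Icc 0 1) 0 := by
  have hgrad := contDiffOn_grad_slice hΦ.contDiffOn
  have hmaps : ∀ t ∈ Icc (0 : ℝ) 1, MapsTo (S.grad (Φ t)) S.carrier S.carrier :=
    fun t ht => (hΦ.mem t ht).2.2.mapsTo
  have hderiv : (S.integral fun x =>
      derivWithin (fun t => ξ (S.grad (Φ t) x) * q x) (Icc 0 1) 0) =
      S.integral fun x => inner ℝ (S.grad ξ (S.grad (Φ 0) x))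
        (derivWithin (fun t => S.grad (Φ t) x) (Icc 0 1) 0) * q x := by
    refine setIntegral_congr_fun S.measurableSet_cell fun x hx => ?_
    have hx' := S.cell_subset_carrier hx
    have hcurve := (differentiableOn_slice_left (f := fun t => S.grad (Φ t)) hx'
      (hgrad.differentiableOn (by simp)) 0
      unitInterval.zero_mem).hasDerivWithinAt
    have hξ₀ := hasGradientWithinAt_grad
      (hξ.differentiableOn (by simp) _ (hmaps 0 unitInterval.zero_mem hx'))
    exact ((hξ₀.hasFDerivWithinAt.comp_hasDerivWithinAt 0 hcurve fun t ht =>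
      hmaps t ht hx').mul_const (q x)).derivWithin
        (uniqueDiffOn_Icc_zero_one 0 unitInterval.zero_mem)
  rw [← hderiv]
  exact hasDerivWithinAt_integral (((hξ.comp hgrad fun z hz => hmaps z.1 hz.1 hz.2).mul
    (hq.comp contDiffOn_snd fun _ hz => hz.2)).of_le (by simp))

/-- The continuity equation for `(∇Φ_t)_# q` at `t = 0`, in weak form. -/
theorem IsSmoothCurve.integral_mul_derivWithin_push (hΦ : S.IsSmoothCurve S.coords Φ)
    (hq : q ∈ S.densities) (hξ : ξ ∈ S.smooth) :
    (S.integral fun y => ξ y * derivWithin (fun t => S.push (Φ t) q y) (Icc 0 1) 0) =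
      S.integral fun x => inner ℝ (S.grad ξ (S.grad (Φ 0) x))
        (derivWithin (fun t => S.grad (Φ t) x) (Icc 0 1) 0) * q x :=
  (uniqueDiffOn_Icc_zero_one 0 unitInterval.zero_mem).eq_deriv _
    ((hΦ.push hq).hasDerivWithinAt_integral_mul hξ.1)
    ((hΦ.hasDerivWithinAt_integral_comp_grad_mul hξ.1 hq.1.1).congr_of_mem
      (fun t ht => integral_mul_push (hΦ.mem t ht) hq.1.2 hξ.2) unitInterval.zero_mem)

end SmoothCurve

section Oscillation

variable {Φ : E d → ℝ} {x y v : E d}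

theorem inner_grad_sub_le (hΦ : Φ ∈ S.coords) (hx : x ∈ S.carrier) (hy : y ∈ S.carrier) :
    inner ℝ (S.grad Φ x) (y - x) ≤ Φ y - Φ x := by
  have hc := contDiffOn_of_mem_coords hΦ
  have hhess : ∀ z ∈ S.carrier, ∀ w : E d, 0 * ‖w‖ ^ 2 ≤ inner ℝ (S.hess Φ z w) w := by
    intro z hz w
    rcases eq_or_ne w 0 with rfl | hw
    · simp
    · simpa using (hΦ.2.1 z hz w hw).le
  refine inner_sub_le_of_hasGradientWithinAt S.convex_carrier
    (fun z hz => hasGradientWithinAt_grad (hc.differentiableOn (by simp) z hz))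
    (fun z hz w hw => ?_) hx hy
  simpa only [zero_mul] using le_inner_sub_of_hasFDerivWithinAt S.convex_carrier
    (fun z hz => hasFDerivWithinAt_grad hc hz) hhess hz hw

theorem inner_grad_sub_self_le_quad (hΦ : Φ ∈ S.coords) (hv : v ∈ S.periods)
    (hx : x ∈ S.carrier) : inner ℝ (S.grad Φ x - x) v ≤ quad v := by
  have hle := inner_grad_sub_le hΦ hx ((add_mem_carrier_iff hv).2 hx)
  rw [potential_add_period hΦ.1 hv, add_sub_cancel_left, add_sub_cancel_left,
    ← sub_le_iff_le_add', real_inner_comm x v, ← inner_sub_left] at hle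
  exact hle

theorem abs_grad_sub_apply_le {Φ : E d → ℝ} (hΦ : Φ ∈ (torus : SampleSpace d).coords) (x : E d)
    (i : Fin d) : |(torus.grad Φ x - x) i| ≤ 1 / 2 := by
  have hle (n : ℤ) : (torus.grad Φ x - x) i * n ≤ (n : ℝ) ^ 2 / 2 := by
    have hperiod : EuclideanSpace.single i (n : ℝ) ∈ (torus : SampleSpace d).periods :=
      fun j => ⟨if j = i then n else 0, by by_cases h : j = i <;> simp [h]⟩
    simpa [quad, EuclideanSpace.inner_single_right, mul_comm] using
      inner_grad_sub_self_le_quad hΦ hperiod (mem_univ x)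
  have hone := hle 1
  have hneg := hle (-1)
  push_cast at hone hneg
  exact abs_le.2 ⟨by linarith, by linarith⟩

theorem exists_forall_norm_grad_sub_self_le (S : SampleSpace d) :
    ∃ C, ∀ Φ ∈ S.coords, ∀ x ∈ S.carrier, ‖S.grad Φ x - x‖ ≤ C := by
  cases S with
  | body Ω hc hv hi =>
    refine ⟨Metric.diam Ω, fun Φ hΦ x hx => ?_⟩
    rw [← dist_eq_norm]
    exact Metric.dist_le_diam_of_mem hc.isBounded (hΦ.2.2.mapsTo hx) hx
  | torus =>
    refine ⟨√(∑ _ : Fin d, (1 / 2) ^ 2), fun Φ hΦ x _ => ?_⟩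
    rw [EuclideanSpace.norm_eq]
    gcongr with i
    exact abs_grad_sub_apply_le hΦ x i

theorem exists_forall_abs_sub_const_le (S : SampleSpace d) :
    ∃ C, ∀ Φ ∈ S.coords, ∃ a, ∀ x ∈ S.cell, |Φ x - a| ≤ C := by
  obtain ⟨C, hC⟩ := S.exists_forall_norm_grad_sub_self_le
  obtain ⟨R, hR⟩ := S.isBounded_cell.exists_norm_le
  obtain ⟨x₀, hx₀⟩ := S.interior_cell_nonempty.mono interior_subset
  have hsub := S.cell_subset_carrier
  refine ⟨C * Metric.diam S.cell + R ^ 2 / 2, fun Φ hΦ => ⟨Φ x₀ - quad x₀, fun x hx => ?_⟩⟩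
  have hderiv : ∀ z ∈ S.carrier, HasFDerivWithinAt (fun z => Φ z - quad z)
      (InnerProductSpace.toDual ℝ (E d) (S.grad Φ z - z)) S.carrier z := by
    intro z hz
    rw [map_sub]
    exact (hasGradientWithinAt_grad ((contDiffOn_of_mem_coords hΦ).differentiableOn (by simp) z
      hz)).hasFDerivWithinAt.sub (hasGradientWithinAt_quad _ z).hasFDerivWithinAt
  have hlip : |Φ x - quad x - (Φ x₀ - quad x₀)| ≤ C * ‖x - x₀‖ :=
    S.convex_carrier.norm_image_sub_le_of_norm_hasFDerivWithin_le hderiv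
      (fun z hz => by rw [LinearIsometryEquiv.norm_map]; exact hC Φ hΦ z hz) (hsub hx₀) (hsub hx)
  have hC₀ : 0 ≤ C := (norm_nonneg _).trans (hC Φ hΦ x₀ (hsub hx₀))
  have hdist : ‖x - x₀‖ ≤ Metric.diam S.cell :=
    dist_eq_norm x x₀ ▸ Metric.dist_le_diam_of_mem S.isBounded_cell hx hx₀
  have hquad : |quad x| ≤ R ^ 2 / 2 := by
    rw [quad, abs_of_nonneg (by positivity)]
    gcongr
    exact hR x hx
  calc |Φ x - (Φ x₀ - quad x₀)| = |(Φ x - quad x - (Φ x₀ - quad x₀)) + quad x| := by ring_nf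
    _ ≤ C * ‖x - x₀‖ + R ^ 2 / 2 := (abs_add_le _ _).trans (add_le_add hlip hquad)
    _ ≤ C * Metric.diam S.cell + R ^ 2 / 2 := by gcongr

end Oscillation

section Pairing

variable {f g h η : E d → ℝ}

theorem integrableOn_cell (hf : ContinuousOn f S.carrier) : IntegrableOn f S.cell :=
  ((hf.mono S.closure_cell_subset_carrier).integrableOn_compact S.isCompact_closure_cell).mono_set
    subset_closure

/-- The `L²` pairing `∫_Ω f g dx` between potentials and dual variables. -/
noncomputable def pairing (S : SampleSpace d) (f g : E d → ℝ) : ℝ :=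
  S.integral fun x => f x * g x

theorem pairing_comm (S : SampleSpace d) (f g : E d → ℝ) : S.pairing f g = S.pairing g f := by
  simp only [pairing, mul_comm]

theorem pairing_add_right (hf : ContinuousOn f S.carrier) (hg : ContinuousOn g S.carrier)
    (hh : ContinuousOn h S.carrier) : S.pairing f (g + h) = S.pairing f g + S.pairing f h := by
  simp only [pairing, Pi.add_apply, mul_add]
  exact integral_add (integrableOn_cell (hf.mul hg)) (integrableOn_cell (hf.mul hh))

theorem pairing_smul_right (S : SampleSpace d) (f g : E d → ℝ) (t : ℝ) :
    S.pairing f (t • g) = t * S.pairing f g := by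
  simp only [pairing, Pi.smul_apply, smul_eq_mul, mul_left_comm _ t]
  exact integral_const_mul t _

theorem pairing_sub_right (hf : ContinuousOn f S.carrier) (hg : ContinuousOn g S.carrier)
    (hh : ContinuousOn h S.carrier) : S.pairing f (g - h) = S.pairing f g - S.pairing f h := by
  simp only [pairing, Pi.sub_apply, mul_sub]
  exact integral_sub (integrableOn_cell (hf.mul hg)) (integrableOn_cell (hf.mul hh))

theorem pairing_sub_left (hf : ContinuousOn f S.carrier) (hg : ContinuousOn g S.carrier)
    (hh : ContinuousOn h S.carrier) : S.pairing (f - g) h = S.pairing f h - S.pairing g h := by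
  rw [pairing_comm, pairing_sub_right hh hf hg, pairing_comm S h f, pairing_comm S h g]

theorem pairing_const_left_of_mem_duals (hη : η ∈ S.duals) (a : ℝ) :
    S.pairing (fun _ => a) η = 0 :=
  (integral_const_mul a _).trans (mul_eq_zero_of_right a hη.2)

theorem continuousOn_of_mem_duals (hη : η ∈ S.duals) : ContinuousOn η S.carrier :=
  hη.1.1.continuousOn

theorem add_mem_duals (hf : f ∈ S.duals) (hg : g ∈ S.duals) : f + g ∈ S.duals := by
  refine ⟨⟨hf.1.1.add hg.1.1, fun v hv x => by
    simp only [Pi.add_apply, hf.1.2 v hv x, hg.1.2 v hv x]⟩, ?_⟩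
  exact (integral_add (integrableOn_cell (continuousOn_of_mem_duals hf))
    (integrableOn_cell (continuousOn_of_mem_duals hg))).trans (by
      rw [← integral, ← integral, hf.2, hg.2, add_zero])

theorem smul_mem_duals (hf : f ∈ S.duals) (t : ℝ) : t • f ∈ S.duals :=
  ⟨⟨hf.1.1.const_smul t, fun v hv x => congrArg (t • ·) (hf.1.2 v hv x)⟩,
    (MeasureTheory.integral_smul t f).trans (by rw [← integral, hf.2, smul_zero])⟩

theorem sub_const_mem_duals (hf : f ∈ S.smooth) :
    (fun x => f x - ⨍ y in S.cell, f y) ∈ S.duals := by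
  have : IsFiniteMeasure (volume.restrict S.cell) := ⟨by simpa using S.volume_cell_lt_top⟩
  exact ⟨⟨hf.1.sub contDiffOn_const, fun v hv x => congrArg (· - _) (hf.2 v hv x)⟩,
    integral_sub_average _ f⟩

theorem exists_eqOn_const_of_forall_pairing_eq_zero (hf : f ∈ S.smooth)
    (horth : ∀ η ∈ S.duals, S.pairing f η = 0) : ∃ a, EqOn f (fun _ => a) S.carrier := by
  set a := ⨍ y in S.cell, f y
  have hη : (f - fun _ => a) ∈ S.duals := sub_const_mem_duals hf
  have hcont := continuousOn_of_mem_duals hη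
  have hself : S.pairing (f - fun _ => a) (f - fun _ => a) = 0 := by
    rw [pairing_sub_left hf.1.continuousOn continuousOn_const hcont, horth _ hη,
      pairing_const_left_of_mem_duals hη, sub_zero]
  have hae := (setIntegral_eq_zero_iff_of_nonneg_ae (Eventually.of_forall fun _ =>
    mul_self_nonneg _) (integrableOn_cell (hcont.mul hcont))).1 hself
  have heq := eqOn_zero_of_ae_eq_zero_cell hη.1 (hae.mono fun x hx => mul_self_eq_zero.1 hx)
  exact ⟨a, fun x hx => sub_eq_zero.1 (heq hx)⟩

theorem exists_forall_pairing_le (hη : η ∈ S.duals) :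
    ∃ M, ∀ Φ ∈ S.coords, S.pairing Φ η ≤ M := by
  obtain ⟨C, hC⟩ := S.exists_forall_abs_sub_const_le
  refine ⟨S.integral fun x => C * |η x|, fun Φ hΦ => ?_⟩
  obtain ⟨a, ha⟩ := hC Φ hΦ
  have hcont : ContinuousOn Φ S.carrier := (contDiffOn_of_mem_coords hΦ).continuousOn
  have hη' := continuousOn_of_mem_duals hη
  calc S.pairing Φ η = S.pairing (Φ - fun _ => a) η := by
        rw [pairing_sub_left hcont continuousOn_const hη', pairing_const_left_of_mem_duals hη,
          sub_zero]
    _ ≤ S.integral fun x => C * |η x| := by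
        refine setIntegral_mono_on
          (integrableOn_cell ((hcont.sub continuousOn_const).mul hη'))
          (integrableOn_cell (continuousOn_const.mul hη'.abs)) S.measurableSet_cell fun x hx => ?_
        refine (le_abs_self _).trans ?_
        rw [abs_mul]
        exact mul_le_mul_of_nonneg_right (ha x hx) (abs_nonneg _)

end Pairing

section Legendre

variable {K : Set (E d → ℝ)} {G : (E d → ℝ) → ℝ} {Φ Φ' η η' Ψ : E d → ℝ}

theorem IsFirstVariation.mem_duals (hΦ : ContDiffOn ℝ ∞ Φ S.carrier)
    (hK : ∀ a : ℝ, (fun x => Φ x + a) ∈ K) (hG : ∀ a : ℝ, G (fun x => Φ x + a) = G Φ)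
    (hη : η ∈ S.smooth) (h : S.IsFirstVariation K G Φ η) : η ∈ S.duals := by
  have hconst (t : ℝ) : Φ + t • (1 : E d → ℝ) = fun x => Φ x + t := by
    funext x
    simp
  have hcurve : S.IsSmoothCurve K fun t => Φ + t • 1 :=
    isSmoothCurve_add_smul hΦ contDiffOn_const fun t _ => hconst t ▸ hK t
  have hzero : S.pairing η 1 = 0 := (uniqueDiffOn_Icc_zero_one 0 unitInterval.zero_mem).eq_deriv _
    (h.hasDerivWithinAt_add_smul hcurve) ((hasDerivWithinAt_const _ _ (G Φ)).congr_of_mem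
      (fun t _ => by rw [hconst, hG]) unitInterval.zero_mem)
  exact ⟨hη, by simpa [pairing] using hzero⟩

theorem IsFirstVariation.pairing_sub_le (hK : ∀ Φ ∈ K, ContDiffOn ℝ ∞ Φ S.carrier)
    (hG : ConvexOn ℝ K G) (h : S.IsFirstVariation K G Φ η) (hΦ' : Φ' ∈ K) :
    S.pairing η (Φ' - Φ) ≤ G Φ' - G Φ := by
  have hcurve := isSmoothCurve_add_smul (hK Φ h.1) ((hK Φ' hΦ').sub (hK Φ h.1))
    fun t ht => hG.1.add_smul_sub_mem h.1 hΦ' ht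
  refine le_of_hasDerivWithinAt_of_le zero_lt_one (h.hasDerivWithinAt_add_smul hcurve)
    (hasDerivWithinAt_const_add_smul (G Φ) (G Φ' - G Φ) _ 0) (by simp) fun t ht => ?_
  calc G (Φ + t • (Φ' - Φ)) = G ((1 - t) • Φ + t • Φ') := by congr 1; module
    _ ≤ (1 - t) • G Φ + t • G Φ' := hG.2 h.1 hΦ' (sub_nonneg.2 ht.2) ht.1 (by ring)
    _ = G Φ + t • (G Φ' - G Φ) := by module

theorem IsFirstVariation.pairing_sub_le_pairing_sub (hK : ∀ Φ ∈ K, ContDiffOn ℝ ∞ Φ S.carrier)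
    (hG : ConvexOn ℝ K G) (hη : ContinuousOn η S.carrier) (h : S.IsFirstVariation K G Φ η)
    (hΦ' : Φ' ∈ K) : S.pairing Φ' η - G Φ' ≤ S.pairing Φ η - G Φ := by
  have hle := h.pairing_sub_le hK hG hΦ'
  rw [pairing_sub_right hη (hK Φ' hΦ').continuousOn (hK Φ h.1).continuousOn, pairing_comm S η Φ',
    pairing_comm S η Φ] at hle
  linarith

theorem IsFirstVariation.bddAbove_conjValues (hK : K ⊆ S.coords) (hG : ConvexOn ℝ K G)
    (hη : η ∈ S.duals) (h : S.IsFirstVariation K G Φ η) (hη' : η' ∈ S.duals) :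
    BddAbove (S.conjValues K G η') := by
  have hdiff : η' + (-1 : ℝ) • η ∈ S.duals := add_mem_duals hη' (smul_mem_duals hη _)
  obtain ⟨M, hM⟩ := exists_forall_pairing_le hdiff
  refine ⟨M + (S.pairing Φ η - G Φ), ?_⟩
  rintro _ ⟨Φ', hΦ', rfl⟩
  have hcont := (contDiffOn_of_mem_coords (hK hΦ')).continuousOn
  have hsplit := hM Φ' (hK hΦ')
  rw [pairing_add_right hcont (continuousOn_of_mem_duals hη')
    (continuousOn_of_mem_duals (smul_mem_duals hη _)), pairing_smul_right] at hsplit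
  have hfenchel := h.pairing_sub_le_pairing_sub (fun Φ hΦ => contDiffOn_of_mem_coords (hK hΦ)) hG
    (continuousOn_of_mem_duals hη) hΦ'
  rw [← pairing]
  linarith

theorem IsFirstVariation.conj_eq (hK : ∀ Φ ∈ K, ContDiffOn ℝ ∞ Φ S.carrier)
    (hG : ConvexOn ℝ K G) (hη : ContinuousOn η S.carrier) (h : S.IsFirstVariation K G Φ η) :
    S.conj K G η = S.pairing Φ η - G Φ := by
  refine IsGreatest.csSup_eq ⟨⟨Φ, h.1, rfl⟩, ?_⟩
  rintro _ ⟨Φ', hΦ', rfl⟩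
  exact h.pairing_sub_le_pairing_sub hK hG hη hΦ'

theorem pairing_le_of_isFirstVariation_conj (hK : ∀ Φ ∈ K, ContDiffOn ℝ ∞ Φ S.carrier)
    (hG : ConvexOn ℝ K G) (hbdd : ∀ y ∈ S.duals, BddAbove (S.conjValues K G y))
    (h : S.IsFirstVariation K G Φ η) (hconj : S.IsFirstVariation S.duals (S.conj K G) η Ψ)
    (hη' : η' ∈ S.duals) : S.pairing Φ η' ≤ S.pairing Ψ η' := by
  have hη := hconj.1
  have hΦ := (hK Φ h.1).continuousOn
  have hmem (t : ℝ) : η + t • η' ∈ S.duals := add_mem_duals hη (smul_mem_duals hη' t)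
  have heq := h.conj_eq hK hG (continuousOn_of_mem_duals hη)
  refine le_of_hasDerivWithinAt_of_le zero_lt_one
    (hasDerivWithinAt_const_add_smul (S.conj K G η) (S.pairing Φ η') _ 0)
    (hconj.hasDerivWithinAt_add_smul (isSmoothCurve_add_smul hη.1.1 hη'.1.1 fun t _ => hmem t))
    (by simp) fun t _ => ?_
  calc S.conj K G η + t • S.pairing Φ η' = S.pairing Φ (η + t • η') - G Φ := by
        rw [pairing_add_right hΦ (continuousOn_of_mem_duals hη)
          (continuousOn_of_mem_duals (smul_mem_duals hη' t)), pairing_smul_right, heq, smul_eq_mul]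
        ring
    _ ≤ S.conj K G (η + t • η') := le_csSup (hbdd _ (hmem t)) ⟨Φ, h.1, rfl⟩

theorem pairing_eq_of_isFirstVariation_conj (hK : ∀ Φ ∈ K, ContDiffOn ℝ ∞ Φ S.carrier)
    (hG : ConvexOn ℝ K G) (hbdd : ∀ y ∈ S.duals, BddAbove (S.conjValues K G y))
    (h : S.IsFirstVariation K G Φ η) (hconj : S.IsFirstVariation S.duals (S.conj K G) η Ψ)
    (hη' : η' ∈ S.duals) : S.pairing Ψ η' = S.pairing Φ η' := by
  refine le_antisymm ?_ (pairing_le_of_isFirstVariation_conj hK hG hbdd h hconj hη')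
  simpa only [pairing_smul_right, neg_one_mul, neg_le_neg_iff] using
    pairing_le_of_isFirstVariation_conj hK hG hbdd h hconj (smul_mem_duals hη' (-1))

theorem grad_eq_of_isFirstVariation_conj (hK : K ⊆ S.potentials) (hG : ConvexOn ℝ K G)
    (hbdd : ∀ y ∈ S.duals, BddAbove (S.conjValues K G y)) (h : S.IsFirstVariation K G Φ η)
    (hΨ : Ψ ∈ S.potentials) (hconj : S.IsFirstVariation S.duals (S.conj K G) η Ψ) {x : E d}
    (hx : x ∈ S.carrier) : S.grad Ψ x = S.grad Φ x := by
  have hcont {Θ : E d → ℝ} (hΘ : Θ ∈ S.potentials) := (contDiffOn_of_mem_potentials hΘ).continuousOn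
  obtain ⟨a, ha⟩ := exists_eqOn_const_of_forall_pairing_eq_zero
    (sub_mem_smooth hΨ (hK h.1)) fun η' hη' => by
      rw [pairing_sub_left (hcont hΨ) (hcont (hK h.1)) (continuousOn_of_mem_duals hη'),
        pairing_eq_of_isFirstVariation_conj (fun Φ hΦ => contDiffOn_of_mem_potentials (hK hΦ)) hG
          hbdd h hconj hη', sub_self]
  rw [← grad_add_const Φ a]
  exact grad_congr (fun y hy => eq_add_of_sub_eq' (ha hy)) hx

theorem bregman_eq_bregman_conj {Φ₁ Φ₂ η₁ η₂ : E d → ℝ}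
    (hK : ∀ Φ ∈ K, ContDiffOn ℝ ∞ Φ S.carrier) (hG : ConvexOn ℝ K G)
    (hbdd : ∀ y ∈ S.duals, BddAbove (S.conjValues K G y)) (h₁ : S.IsFirstVariation K G Φ₁ η₁)
    (hη₂ : η₂ ∈ S.duals) (h₂ : S.IsFirstVariation K G Φ₂ η₂)
    (hconj : S.IsFirstVariation S.duals (S.conj K G) η₁ Ψ) :
    S.bregman G Φ₁ Φ₂ η₂ = S.bregman (S.conj K G) η₂ η₁ Ψ := by
  have hΦ₁ := (hK Φ₁ h₁.1).continuousOn
  have hη₁' := continuousOn_of_mem_duals hconj.1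
  have hη₂' := continuousOn_of_mem_duals hη₂
  have hdiff : η₂ - η₁ ∈ S.duals := by
    simpa only [neg_one_smul, ← sub_eq_add_neg] using
      add_mem_duals hη₂ (smul_mem_duals hconj.1 (-1))
  calc S.bregman G Φ₁ Φ₂ η₂ = G Φ₁ - G Φ₂ - (S.pairing Φ₁ η₂ - S.pairing Φ₂ η₂) :=
        congrArg _ (pairing_sub_left hΦ₁ (hK Φ₂ h₂.1).continuousOn hη₂')
    _ = S.conj K G η₂ - S.conj K G η₁ - (S.pairing Φ₁ η₂ - S.pairing Φ₁ η₁) := by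
        rw [h₁.conj_eq hK hG hη₁', h₂.conj_eq hK hG hη₂']
        ring
    _ = S.conj K G η₂ - S.conj K G η₁ - S.pairing (η₂ - η₁) Ψ := by
        rw [pairing_comm S _ Ψ, pairing_eq_of_isFirstVariation_conj hK hG hbdd h₁ hconj hdiff,
          pairing_sub_right hΦ₁ hη₂' hη₁']

end Legendre

section Transport

variable {F : (E d → ℝ) → ℝ} {K : Set (E d → ℝ)} {q p Φ ξ η : E d → ℝ}

theorem lift_add_const (S : SampleSpace d) (F : (E d → ℝ) → ℝ) (q Φ : E d → ℝ) (a : ℝ) :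
    S.lift F q (fun x => Φ x + a) = S.lift F q Φ := by
  rw [lift, push_add_const, lift]

theorem IsFirstVariation.pairing_eq_of_lift (hq : q ∈ S.densities) (hK : K ⊆ S.coords)
    (hconv : Convex ℝ K) (hΦ : Φ ∈ K) (hξ : ξ ∈ S.smooth)
    (hF : S.IsFirstVariation S.densities F q ξ) (h : S.IsFirstVariation K (S.lift F q) quad η) :
    S.pairing η (Φ - quad) =
      S.integral fun x => inner ℝ (S.grad ξ x) (S.grad Φ x - S.grad quad x) * q x := by
  have hsmooth := contDiffOn_of_mem_coords (hK hΦ)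
  have hsmooth₀ := contDiffOn_of_mem_coords (hK h.1)
  have hcurve : S.IsSmoothCurve K fun t => quad + t • (Φ - quad) :=
    isSmoothCurve_add_smul hsmooth₀ (hsmooth.sub hsmooth₀)
      fun t ht => hconv.add_smul_sub_mem h.1 hΦ ht
  have hcurve' : S.IsSmoothCurve S.coords fun t => quad + t • (Φ - quad) :=
    ⟨hcurve.contDiffOn, fun t ht => hK (hcurve.mem t ht)⟩
  have hpush := hF.hasDerivWithinAt (hcurve'.push hq)
    (by simp only [zero_smul, add_zero, push_quad (hK h.1) hq.2.2.1])
  refine ((uniqueDiffOn_Icc_zero_one 0 unitInterval.zero_mem).eq_deriv _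
    (h.hasDerivWithinAt_add_smul hcurve) hpush).trans ?_
  rw [hcurve'.integral_mul_derivWithin_push hq hξ]
  refine setIntegral_congr_fun S.measurableSet_cell fun x hx => ?_
  have hx' := S.cell_subset_carrier hx
  have hdiff := hsmooth.differentiableOn (by simp) x hx'
  have hdiff₀ := hsmooth₀.differentiableOn (by simp) x hx'
  have hvelocity : derivWithin (fun t : ℝ => S.grad (quad + t • (Φ - quad)) x) (Icc 0 1) 0 =
      S.grad Φ x - S.grad quad x := by
    simp only [grad_add_smul hx' hdiff₀ (hdiff.sub hdiff₀), grad_sub hx' hdiff hdiff₀]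
    exact (hasDerivWithinAt_const_add_smul _ _ _ 0).derivWithin
      (uniqueDiffOn_Icc_zero_one 0 unitInterval.zero_mem)
  simp only [hvelocity, zero_smul, add_zero, grad_quad hx']

theorem transportBregman_eq_bregman (hq : q ∈ S.densities) (hK : K ⊆ S.coords)
    (hconv : Convex ℝ K) (hp : ∀ x, x ∉ S.carrier → p x = 0) (hΦ : Φ ∈ K)
    (hpush : S.IsPush Φ q p) (hξ : ξ ∈ S.smooth) (hF : S.IsFirstVariation S.densities F q ξ)
    (h : S.IsFirstVariation K (S.lift F q) quad η) :
    S.transportBregman F p q Φ ξ = S.bregman (S.lift F q) Φ quad η := by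
  have hpairing := hF.pairing_eq_of_lift hq hK hconv hΦ hξ h
  rw [pairing_comm] at hpairing
  rw [transportBregman, bregman, ← hpairing, lift, lift, ← push_eq_of_isPush (hK hΦ) hp hpush,
    push_quad (hK h.1) hq.2.2.1]
  rfl

end Transport

end SampleSpace

theorem mainTheorem2 {d : ℕ} (S : SampleSpace d) (F : (E d → ℝ) → ℝ)
    (q : E d → ℝ) (hq : q ∈ S.densities)
    (K : Set (E d → ℝ)) (hK : K ⊆ S.coords)
    (hKconst : ∀ Φ ∈ K, ∀ a : ℝ, (fun x => Φ x + a) ∈ K)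
    (hconv : ConvexOn ℝ K (S.lift F q)) :
    -- the conjugate is finite on the dual variables
    (∀ Φ Φs : E d → ℝ, Φs ∈ S.smooth →
      S.IsFirstVariation K (S.lift F q) Φ Φs →
      Φs ∈ S.duals ∧ ∀ y ∈ S.duals, BddAbove (S.conjValues K (S.lift F q) y)) ∧
    -- (i)
    (∀ Φ Φs Ψ : E d → ℝ, Φs ∈ S.smooth → Ψ ∈ S.potentials →
      S.IsFirstVariation K (S.lift F q) Φ Φs →
      S.IsFirstVariation S.duals (S.conj K (S.lift F q)) Φs Ψ →
      ∀ x ∈ S.carrier, S.grad Ψ x = S.grad Φ x) ∧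
    -- (ii)
    (∀ p Φp ξ Φqs : E d → ℝ,
      p ∈ S.densities → Φp ∈ K → S.IsPush Φp q p →
      ξ ∈ S.smooth → S.IsFirstVariation S.densities F q ξ →
      Φqs ∈ S.smooth →
      S.IsFirstVariation K (S.lift F q) SampleSpace.quad Φqs →
      S.transportBregman F p q Φp ξ =
        S.bregman (S.lift F q) Φp SampleSpace.quad Φqs) ∧
    -- (iii)
    (∀ p Φp ξ Φqs Φps Ψp : E d → ℝ,
      p ∈ S.densities → Φp ∈ K → S.IsPush Φp q p →
      ξ ∈ S.smooth → S.IsFirstVariation S.densities F q ξ →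
      Φqs ∈ S.smooth →
      S.IsFirstVariation K (S.lift F q) SampleSpace.quad Φqs →
      Φps ∈ S.smooth →
      S.IsFirstVariation K (S.lift F q) Φp Φps →
      Ψp ∈ S.potentials →
      S.IsFirstVariation S.duals (S.conj K (S.lift F q)) Φps Ψp →
      S.bregman (S.lift F q) Φp SampleSpace.quad Φqs =
        S.bregman (S.conj K (S.lift F q)) Φqs Φps Ψp ∧
      S.bregman (S.conj K (S.lift F q)) Φqs Φps Ψp =
        S.transportBregman F p q Φp ξ) := by
  have hsmooth : ∀ Φ ∈ K, ContDiffOn ℝ ∞ Φ S.carrier :=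
    fun Φ hΦ => SampleSpace.contDiffOn_of_mem_coords (hK hΦ)
  have hdual : ∀ Φ Φs, Φs ∈ S.smooth → S.IsFirstVariation K (S.lift F q) Φ Φs → Φs ∈ S.duals :=
    fun Φ Φs hs h => h.mem_duals (hsmooth Φ h.1) (hKconst Φ h.1) (S.lift_add_const F q Φ) hs
  have hbdd : ∀ Φ Φs, Φs ∈ S.smooth → S.IsFirstVariation K (S.lift F q) Φ Φs →
      ∀ y ∈ S.duals, BddAbove (S.conjValues K (S.lift F q) y) :=
    fun Φ Φs hs h y hy => h.bddAbove_conjValues hK hconv (hdual Φ Φs hs h) hy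
  refine ⟨fun Φ Φs hs h => ⟨hdual Φ Φs hs h, hbdd Φ Φs hs h⟩, ?_, ?_, ?_⟩
  · intro Φ Φs Ψ hs hΨ h hconj x hx
    exact SampleSpace.grad_eq_of_isFirstVariation_conj (fun _ hΘ => (hK hΘ).1) hconv
      (hbdd Φ Φs hs h) h hΨ hconj hx
  · intro p Φp ξ Φqs hp hΦp hpush hξ hF _ h
    exact SampleSpace.transportBregman_eq_bregman hq hK hconv.1 hp.2.2.1 hΦp hpush hξ hF h
  · intro p Φp ξ Φqs Φps Ψp hp hΦp hpush hξ hF hqs h hps h' _ hconj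
    have hconj_eq := SampleSpace.bregman_eq_bregman_conj hsmooth hconv (hbdd Φp Φps hps h') h'
      (hdual _ Φqs hqs h) h hconj
    have htransport := SampleSpace.transportBregman_eq_bregman hq hK hconv.1 hp.2.2.1 hΦp hpush hξ
      hF h
    exact ⟨hconj_eq, hconj_eq.symm.trans htransport.symm⟩
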